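/- An embedding of a finite poset $\mathcal Q=(Q,\le^Q)$ into a finite poset $\mathcal P=(P,\le^P)$ is an injective map $e:Q\to P$ such that $q\le^Q q'$ if and only if $e(q)\le^P e(q')$ for all $q,q'\in Q$; the width of $\mathcal P$ is the maximum cardinality of an antichain of $\mathcal P$. The problem Embedding asks, given $\mathcal Q$ and $\mathcal P$, whether there is an embedding of $\mathcal Q$ into $\mathcal P$. Embedding can be solved in time $O\big(\mathrm{width}(\mathcal P)^{|Q|}\cdot|Q|^3\cdot|P|^2\big)$. Precisely: there are one word RAM program and constants $c,C\in\mathbb N$ such that, for all finite posets $\mathcal Q,\mathcal P$, given by $|Q|$, $|P|$ and the 0/1 matrices of $\le^Q$ and $\le^P$ with respect to arbitrary numberings of their elements, and for every word length $b$ with $2^b\ge c\,(|Q|+|P|+1)^2$, the program, run on a machine with $b$-bit words, halts without overflow after at most $$C\cdot\max\big\{1,\ \mathrm{width}(\mathcal P)^{|Q|}\cdot|Q|^3\cdot|P|^2\big\}$$ steps and outputs $1$ if there is an embedding of $\mathcal Q$ into $\mathcal P$ and $0$ otherwise. (The maximum with $1$ matters only when $Q$ or $P$ is empty.) A step is one elementary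 operation: assigning a constant or a copy, addition, truncated subtraction or multiplication of two words, an indirect memory read or write, or a comparison of two registers; the program is built from these by sequencing, branching and while loops. -/

import Mathlib

open Classical in
/-- The width of a finite poset: the maximum cardinality of an antichain. -/
noncomputable def posetWidth (P : Type*) [Fintype P] [PartialOrder P] : ℕ :=
  (Finset.univ.filter (fun A : Finset P => IsAntichain (· ≤ ·) (A : Set P))).sup Finset.card

namespace WordRAM

/-- A configuration of the word RAM: registers (a program mentions only finitely many of them)
and a random access memory. -/
structure State where
  reg : ℕ → ℕ
  mem : ℕ → ℕ

/-- The elementary instructions; all arguments except the `v` of `const` are register names. -/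
inductive Instr where
  /-- `d := v` -/
  | const (d v : ℕ)
  /-- `d := a` -/
  | copy (d a : ℕ)
  /-- `d := a + a'` -/
  | add (d a a' : ℕ)
  /-- `d := max (a - a') 0` -/
  | sub (d a a' : ℕ)
  /-- `d := a * a'` -/
  | mul (d a a' : ℕ)
  /-- `d := mem[a]` -/
  | load (d a : ℕ)
  /-- `mem[a] := s` -/
  | store (a s : ℕ)

/-- Comparison of two registers. -/
inductive Test where
  | lt (a a' : ℕ)
  | eq (a a' : ℕ)

/-- Programs: elementary instructions combined by structured control flow. -/
inductive Prog where
  | skip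
  | instr (i : Instr)
  | seq (p q : Prog)
  | ite (c : Test) (p q : Prog)
  | loop (c : Test) (p : Prog)

/-- Write `v` into register `d`; the machine has `b`-bit words, and a value that does not fit
into a word is an error (`none`). -/
def State.setReg (b : ℕ) (s : State) (d v : ℕ) : Option State :=
  if v < 2 ^ b then some { s with reg := Function.update s.reg d v } else none

/-- Effect of one elementary instruction on a machine with `b`-bit words. -/
def Instr.step (b : ℕ) (s : State) : Instr → Option State
  | .const d v => s.setReg b d v
  | .copy d a => s.setReg b d (s.reg a)
  | .add d a a' => s.setReg b d (s.reg a + s.reg a')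
  | .sub d a a' => s.setReg b d (s.reg a - s.reg a')
  | .mul d a a' => s.setReg b d (s.reg a * s.reg a')
  | .load d a => s.setReg b d (s.mem (s.reg a))
  | .store a r => some { s with mem := Function.update s.mem (s.reg a) (s.reg r) }

/-- Truth of a test in a configuration. -/
def Test.Holds (s : State) : Test → Prop
  | .lt a a' => s.reg a < s.reg a'
  | .eq a a' => s.reg a = s.reg a'

/-- `Exec b p s s' t`: on a machine with `b`-bit words the program `p`, started in the
configuration `s`, halts without error in the configuration `s'` after exactly `t` steps. Every
elementary instruction and every evaluation of a test is one step. -/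
inductive Exec (b : ℕ) : Prog → State → State → ℕ → Prop where
  | skip (s : State) : Exec b .skip s s 1
  | instr {i : Instr} {s s' : State} (h : i.step b s = some s') : Exec b (.instr i) s s' 1
  | seq {p q : Prog} {s s' s'' : State} {t t' : ℕ}
      (hp : Exec b p s s' t) (hq : Exec b q s' s'' t') : Exec b (.seq p q) s s'' (t + t')
  | ite_true {c : Test} {p q : Prog} {s s' : State} {t : ℕ}
      (hc : c.Holds s) (hp : Exec b p s s' t) : Exec b (.ite c p q) s s' (t + 1)
  | ite_false {c : Test} {p q : Prog} {s s' : State} {t : ℕ}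
      (hc : ¬ c.Holds s) (hq : Exec b q s s' t) : Exec b (.ite c p q) s s' (t + 1)
  | loop_done {c : Test} {p : Prog} {s : State}
      (hc : ¬ c.Holds s) : Exec b (.loop c p) s s 1
  | loop_step {c : Test} {p : Prog} {s s' s'' : State} {t t' : ℕ}
      (hc : c.Holds s) (hp : Exec b p s s' t) (hl : Exec b (.loop c p) s' s'' t') :
      Exec b (.loop c p) s s'' (t + 1 + t')

/-- Runs are deterministic: final configuration and number of steps are determined. -/
theorem Exec.deterministic {b : ℕ} {p : Prog} {s s₁ s₂ : State} {t₁ t₂ : ℕ}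
    (h₁ : Exec b p s s₁ t₁) (h₂ : Exec b p s s₂ t₂) : s₁ = s₂ ∧ t₁ = t₂ := by
  induction h₁ generalizing s₂ t₂ with
  | skip s => cases h₂; exact ⟨rfl, rfl⟩
  | instr h => cases h₂ with
    | instr h' => exact ⟨Option.some.inj (h.symm.trans h'), rfl⟩
  | seq _ _ ihp ihq => cases h₂ with
    | seq hp' hq' =>
      obtain ⟨rfl, rfl⟩ := ihp hp'
      obtain ⟨rfl, rfl⟩ := ihq hq'
      exact ⟨rfl, rfl⟩
  | ite_true hc _ ih => cases h₂ with
    | ite_true _ hp' => obtain ⟨rfl, rfl⟩ := ih hp'; exact ⟨rfl, rfl⟩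
    | ite_false hc' _ => exact absurd hc hc'
  | ite_false hc _ ih => cases h₂ with
    | ite_true hc' _ => exact absurd hc' hc
    | ite_false _ hq' => obtain ⟨rfl, rfl⟩ := ih hq'; exact ⟨rfl, rfl⟩
  | loop_done hc => cases h₂ with
    | loop_done _ => exact ⟨rfl, rfl⟩
    | loop_step hc' _ _ => exact absurd hc' hc
  | loop_step hc _ _ ihp ihl => cases h₂ with
    | loop_done hc' => exact absurd hc hc'
    | loop_step _ hp' hl' =>
      obtain ⟨rfl, rfl⟩ := ihp hp'
      obtain ⟨rfl, rfl⟩ := ihl hl'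
      exact ⟨rfl, rfl⟩

open Classical in
/-- The initial configuration for a pair of finite posets whose elements are numbered by `eQ` and
`eP`: register 0 holds `k = |Q|`, register 1 holds `n = |P|`, and the memory holds the 0/1-matrix
of the order of `Q` (row by row, at addresses `0, …, k² - 1`) followed by the 0/1-matrix of the
order of `P` (row by row, at addresses `k², …, k² + n² - 1`). Everything else is 0. -/
noncomputable def posetPairInput {Q P : Type*} [Fintype Q] [PartialOrder Q]
    [Fintype P] [PartialOrder P]
    (eQ : Fin (Fintype.card Q) ≃ Q) (eP : Fin (Fintype.card P) ≃ P) : State where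
  reg := fun r =>
    if r = 0 then Fintype.card Q else if r = 1 then Fintype.card P else 0
  mem := fun a =>
    if (∃ i j : Fin (Fintype.card Q),
          a = (i : ℕ) * Fintype.card Q + j ∧ eQ i ≤ eQ j) ∨
       (∃ i j : Fin (Fintype.card P),
          a = Fintype.card Q * Fintype.card Q + (i : ℕ) * Fintype.card P + j ∧ eP i ≤ eP j)
    then 1 else 0

end WordRAM

set_option linter.constructorNameAsVariable false
set_option linter.unusedSimpArgs false

/-! ### Variables, arrays and the abstract state -/

namespace WordRAM

/-! The algorithm combines a constructive Dilworth theorem with a search that never backtracks once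
a chain is fixed for each element of Q.

Chains. P is split into at most width(P) chains by inserting its elements one at a time, each as a
new singleton chain. One pointer starts at the bottom of every chain. While one pointer lies below
another, the lower one moves up its chain, and the element it leaves records the larger one as its
witness. Either the pointers come to rest as an antichain, so there are at most width(P) chains
(`sat_seek`), or a top u has to be passed. Then u is linked below its witness y. The former
predecessor of y becomes a top; it was passed before y was reached, so it has a witness too, and the
rerouting goes on backwards in time until a witness is a bottom. At that point one chain has
disappeared (`sat_augment`). The total cost is O(width(P)²·|P|²).

Search. An embedding sends each element of Q into some chain, so it suffices to try all assignments
of chains. For a fixed assignment, pointers start at the bottoms, and every embedding that respects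
the assignment stays weakly above them. If the order of two pointers disagrees with Q, one specific
pointer cannot be the final image and has to advance (`Forced.reach`). So the process ends in an
embedding or refutes the assignment, after at most |Q|·|P| advances with a scan of O(|Q|²) each. For
|Q| ≥ 2 the decomposition is absorbed because width² ≤ width^|Q| (`total_cost`); the remaining cases
are answered directly.

Machine. `Sat` is a total-correctness predicate on abstract states whose ghost clock dominates the
number of steps; `Sim` ties these states to registers and memory, and `sat_loop` combines an
invariant with a budget of rounds. -/

/-- Names of the scalar variables of the embedding program. -/
inductive Var where
  | k | n | one | x | m | l | lim | i | j | f | g | go | v | w | t | u | y | a | c | res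

/-- Names of the arrays of the embedding program. -/
inductive Arr where
  | prd | nxt | ptr | wit | bot | dig

/-- Register that holds a variable; registers `2` and `3` are scratch registers, registers
`4` and `5` hold base addresses. -/
def Var.reg : Var → ℕ
  | .k => 6 | .n => 7 | .one => 8 | .x => 9 | .m => 10 | .l => 11 | .lim => 12 | .i => 13
  | .j => 14 | .f => 15 | .g => 16 | .go => 17 | .v => 18 | .w => 19 | .t => 20 | .u => 21
  | .y => 22 | .a => 23 | .c => 24 | .res => 25

/-- Position of an array in the interleaved working memory. -/
def Arr.code : Arr → ℕ
  | .prd => 0 | .nxt => 1 | .ptr => 2 | .wit => 3 | .bot => 4 | .dig => 5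

theorem Var.reg_ge (u : Var) : 6 ≤ u.reg := by cases u <;> simp [Var.reg]

theorem Var.reg_injective : Function.Injective Var.reg := by
  intro u v h
  cases u <;> cases v <;> first | rfl | (simp [Var.reg] at h)

theorem Arr.code_lt (r : Arr) : r.code < 8 := by cases r <;> simp [Arr.code]

theorem Arr.code_injective : Function.Injective Arr.code := by
  intro u v h
  cases u <;> cases v <;> first | rfl | (simp [Arr.code] at h)

/-- The abstract state of the embedding program: its variables, its arrays, and a clock. -/
structure Store where
  k : ℕ
  n : ℕ
  one : ℕ
  x : ℕ
  m : ℕ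
  l : ℕ
  lim : ℕ
  i : ℕ
  j : ℕ
  f : ℕ
  g : ℕ
  go : ℕ
  v : ℕ
  w : ℕ
  t : ℕ
  u : ℕ
  y : ℕ
  a : ℕ
  c : ℕ
  res : ℕ
  prd : ℕ → ℕ
  nxt : ℕ → ℕ
  ptr : ℕ → ℕ
  wit : ℕ → ℕ
  bot : ℕ → ℕ
  dig : ℕ → ℕ
  clk : ℕ

namespace Store

def get (h : Store) : Var → ℕ
  | .k => h.k | .n => h.n | .one => h.one | .x => h.x | .m => h.m | .l => h.l | .lim => h.lim
  | .i => h.i | .j => h.j | .f => h.f | .g => h.g | .go => h.go | .v => h.v | .w => h.w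
  | .t => h.t | .u => h.u | .y => h.y | .a => h.a | .c => h.c | .res => h.res

def set (h : Store) (d : Var) (e : ℕ) : Store :=
  match d with
  | .k => { h with k := e } | .n => { h with n := e } | .one => { h with one := e }
  | .x => { h with x := e } | .m => { h with m := e } | .l => { h with l := e }
  | .lim => { h with lim := e } | .i => { h with i := e } | .j => { h with j := e }
  | .f => { h with f := e } | .g => { h with g := e } | .go => { h with go := e }
  | .v => { h with v := e } | .w => { h with w := e } | .t => { h with t := e }
  | .u => { h with u := e } | .y => { h with y := e } | .a => { h with a := e }
  | .c => { h with c := e } | .res => { h with res := e }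

def getA (h : Store) : Arr → ℕ → ℕ
  | .prd => h.prd | .nxt => h.nxt | .ptr => h.ptr | .wit => h.wit | .bot => h.bot
  | .dig => h.dig

def setA (h : Store) (r : Arr) (e : ℕ → ℕ) : Store :=
  match r with
  | .prd => { h with prd := e } | .nxt => { h with nxt := e } | .ptr => { h with ptr := e }
  | .wit => { h with wit := e } | .bot => { h with bot := e } | .dig => { h with dig := e }

def tick (h : Store) (e : ℕ) : Store := { h with clk := h.clk + e }

theorem get_set_self (h : Store) (d : Var) (e : ℕ) : (h.set d e).get d = e := by
  cases d <;> rfl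

theorem get_set_of_ne (h : Store) {d u : Var} (e : ℕ) (hne : u ≠ d) :
    (h.set d e).get u = h.get u := by
  cases d <;> cases u <;> first | rfl | exact absurd rfl hne

theorem getA_setA_self (h : Store) (r : Arr) (e : ℕ → ℕ) : (h.setA r e).getA r = e := by
  cases r <;> rfl

theorem getA_setA_of_ne (h : Store) {r r' : Arr} (e : ℕ → ℕ) (hne : r' ≠ r) :
    (h.setA r e).getA r' = h.getA r' := by
  cases r <;> cases r' <;> first | rfl | exact absurd rfl hne

theorem getA_set (h : Store) (d : Var) (e : ℕ) (r : Arr) : (h.set d e).getA r = h.getA r := by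
  cases d <;> cases r <;> rfl

theorem get_setA (h : Store) (r : Arr) (e : ℕ → ℕ) (u : Var) : (h.setA r e).get u = h.get u := by
  cases r <;> cases u <;> rfl

theorem get_tick (h : Store) (e : ℕ) (u : Var) : (h.tick e).get u = h.get u := by
  cases u <;> rfl

theorem getA_tick (h : Store) (e : ℕ) (r : Arr) : (h.tick e).getA r = h.getA r := by
  cases r <;> rfl

end Store

/-! ### Instances and the simulation relation -/

/-- A problem instance on a machine with `b`-bit words: the orders of two posets with elements
numbered `0, …, K - 1` and `0, …, N - 1`, and a bound `W` for the antichains of the second. -/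
structure Inst where
  b : ℕ
  K : ℕ
  N : ℕ
  W : ℕ
  qle : ℕ → ℕ → Prop
  le : ℕ → ℕ → Prop
  word : 16 * (K + N + 1) ^ 2 ≤ 2 ^ b
  le_refl : ∀ i, i < N → le i i
  le_trans : ∀ i j l, le i j → le j l → le i l
  le_antisymm : ∀ i j, le i j → le j i → i = j
  width : ∀ (m : ℕ) (e : ℕ → ℕ), (∀ i < m, e i < N) →
    (∀ i < m, ∀ j < m, i ≠ j → ¬ le (e i) (e j)) → m ≤ W

variable (I : Inst)

/-- Bound for all values of variables and array entries. -/
def Inst.bd : ℕ := I.K + I.N + 1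

open Classical in
/-- The machine configuration `s` represents the abstract state `h`. -/
structure Sim (h : Store) (s : State) : Prop where
  reg0 : s.reg 0 = I.K
  reg1 : s.reg 1 = I.N
  reg4 : s.reg 4 = I.K * I.K
  reg5 : s.reg 5 = I.K * I.K + I.N * I.N
  var : ∀ u : Var, s.reg u.reg = h.get u
  arr : ∀ (r : Arr) (i : ℕ), s.mem (I.K * I.K + I.N * I.N + 8 * i + r.code) = h.getA r i
  memQ : ∀ i < I.K, ∀ j < I.K, s.mem (i * I.K + j) = if I.qle i j then 1 else 0
  memP : ∀ i < I.N, ∀ j < I.N, s.mem (I.K * I.K + i * I.N + j) = if I.le i j then 1 else 0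
  var_le : ∀ u : Var, h.get u ≤ I.bd
  arr_le : ∀ (r : Arr) (i : ℕ), h.getA r i ≤ I.bd

variable {I}

/-- The largest numbers formed are addresses K² + N² + 8i + code with i ≤ K + N + 1 and code < 8;
the factor 16 covers them. -/
theorem Inst.lt_word {e : ℕ} (he : e < 16 * (I.K + I.N + 1) ^ 2) : e < 2 ^ I.b :=
  lt_of_lt_of_le he I.word

theorem Inst.lt_word_of_le_bd {e : ℕ} (he : e ≤ I.bd) : e < 2 ^ I.b := by
  apply Inst.lt_word
  unfold Inst.bd at he
  nlinarith

theorem Sim.scratch {h : Store} {s : State} (hs : Sim I h s) {r : ℕ} (hr : r = 2 ∨ r = 3) (e : ℕ) :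
    Sim I h { s with reg := Function.update s.reg r e } := by
  obtain ⟨h0, h1, h4, h5, hv, ha, hq, hp, hl, hl'⟩ := hs
  refine ⟨?_, ?_, ?_, ?_, ?_, ha, hq, hp, hl, hl'⟩
  · rcases hr with rfl | rfl <;> simpa using h0
  · rcases hr with rfl | rfl <;> simpa using h1
  · rcases hr with rfl | rfl <;> simpa using h4
  · rcases hr with rfl | rfl <;> simpa using h5
  · intro u
    have := u.reg_ge
    rw [← hv u]
    exact Function.update_of_ne (by omega) _ _

theorem Sim.set {h : Store} {s : State} (hs : Sim I h s) (d : Var) {e : ℕ} (he : e ≤ I.bd) :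
    Sim I (h.set d e) { s with reg := Function.update s.reg d.reg e } := by
  obtain ⟨h0, h1, h4, h5, hv, ha, hq, hp, hl, hl'⟩ := hs
  have hd := d.reg_ge
  refine ⟨?_, ?_, ?_, ?_, ?_, ?_, hq, hp, ?_, ?_⟩
  · rw [← h0]; exact Function.update_of_ne (by omega) _ _
  · rw [← h1]; exact Function.update_of_ne (by omega) _ _
  · rw [← h4]; exact Function.update_of_ne (by omega) _ _
  · rw [← h5]; exact Function.update_of_ne (by omega) _ _
  · intro u
    by_cases hu : u = d
    · subst hu; simp [Store.get_set_self]
    · rw [Store.get_set_of_ne _ _ hu, ← hv u]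
      exact Function.update_of_ne (fun h => hu (Var.reg_injective h)) _ _
  · intro r i; rw [Store.getA_set]; exact ha r i
  · intro u
    by_cases hu : u = d
    · subst hu; rwa [Store.get_set_self]
    · rw [Store.get_set_of_ne _ _ hu]; exact hl u
  · intro r i; rw [Store.getA_set]; exact hl' r i

/-- The stride 8 exceeds every array code, so distinct entries have distinct addresses whatever the
array lengths, and all of them lie beyond the two input matrices. -/
theorem Sim.setA {h : Store} {s : State} (hs : Sim I h s) (r : Arr) (i : ℕ) {e : ℕ}
    (he : e ≤ I.bd) :
    Sim I (h.setA r (Function.update (h.getA r) i e))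
      { s with mem := Function.update s.mem (I.K * I.K + I.N * I.N + 8 * i + r.code) e } := by
  obtain ⟨h0, h1, h4, h5, hv, ha, hq, hp, hl, hl'⟩ := hs
  have hr := r.code_lt
  refine ⟨h0, h1, h4, h5, ?_, ?_, ?_, ?_, ?_, ?_⟩
  · intro u; rw [Store.get_setA]; exact hv u
  · intro r' i'
    have hr' := r'.code_lt
    by_cases h' : r' = r
    · subst h'
      rw [Store.getA_setA_self]
      by_cases hi : i' = i
      · subst hi; simp
      · rw [Function.update_of_ne hi, ← ha r' i']
        exact Function.update_of_ne (by omega) _ _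
    · rw [Store.getA_setA_of_ne _ _ h', ← ha r' i']
      have : r'.code ≠ r.code := fun h => h' (Arr.code_injective h)
      exact Function.update_of_ne (by omega) _ _
  · intro i' hi' j' hj'
    rw [← hq i' hi' j' hj']
    have : i' * I.K + j' < I.K * I.K := by nlinarith
    exact Function.update_of_ne (by omega) _ _
  · intro i' hi' j' hj'
    rw [← hp i' hi' j' hj']
    have : i' * I.N + j' < I.N * I.N := by nlinarith
    exact Function.update_of_ne (by omega) _ _
  · intro u; rw [Store.get_setA]; exact hl u
  · intro r' i'
    by_cases h' : r' = r
    · subst h'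
      rw [Store.getA_setA_self]
      by_cases hi : i' = i
      · subst hi; simpa using he
      · rw [Function.update_of_ne hi]; exact hl' r' i'
    · rw [Store.getA_setA_of_ne _ _ h']; exact hl' r' i'

theorem Sim.tick {h : Store} {s : State} (hs : Sim I h s) (e : ℕ) : Sim I (h.tick e) s := by
  obtain ⟨h0, h1, h4, h5, hv, ha, hq, hp, hl, hl'⟩ := hs
  refine ⟨h0, h1, h4, h5, ?_, ?_, hq, hp, ?_, ?_⟩
  · intro u; rw [Store.get_tick]; exact hv u
  · intro u; rw [Store.getA_tick]; exact ha u
  · intro u; rw [Store.get_tick]; exact hl u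
  · intro u; rw [Store.getA_tick]; exact hl' u

theorem exec_setReg {b : ℕ} {i : Instr} {s : State} {d e : ℕ} (hi : i.step b s = s.setReg b d e)
    (he : e < 2 ^ b) :
    Exec b (.instr i) s { s with reg := Function.update s.reg d e } 1 :=
  .instr (by rw [hi, State.setReg, if_pos he])

-- Program building blocks and their step-counting rules

infixr:60 "⨾" => Prog.seq

/-- `d := e` -/
def assign (d : Var) (e : ℕ) : Prog := .instr (.const d.reg e)

/-- `d := a` -/
def move (d a : Var) : Prog := .instr (.copy d.reg a.reg)

/-- `d := a + a'` -/
def plus (d a a' : Var) : Prog := .instr (.add d.reg a.reg a'.reg)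

/-- Put the address of entry `i` of the array `r` into register 2. -/
def address (r : Arr) (i : Var) : Prog :=
  .instr (.const 2 8) ⨾ .instr (.mul 2 2 i.reg) ⨾ .instr (.const 3 r.code) ⨾
    .instr (.add 2 2 3) ⨾ .instr (.add 2 2 5)

/-- `d := r[i]` -/
def fetch (d : Var) (r : Arr) (i : Var) : Prog := address r i ⨾ .instr (.load d.reg 2)

/-- `r[i] := e` -/
def write (r : Arr) (i e : Var) : Prog := address r i ⨾ .instr (.store 2 e.reg)

/-- `d := [i ≤ j]` in the first poset -/
def fetchQ (d i j : Var) : Prog :=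
  .instr (.mul 2 i.reg 0) ⨾ .instr (.add 2 2 j.reg) ⨾ .instr (.load d.reg 2)

/-- `d := [i ≤ j]` in the second poset -/
def fetchP (d i j : Var) : Prog :=
  .instr (.mul 2 i.reg 1) ⨾ .instr (.add 2 2 j.reg) ⨾ .instr (.add 2 2 4) ⨾
    .instr (.load d.reg 2)

/-- `a < a'` -/
def tlt (a a' : Var) : Test := .lt a.reg a'.reg

/-- `a = a'` -/
def teq (a a' : Var) : Test := .eq a.reg a'.reg

/-- The value of a test in an abstract state. -/
def SatTest (I : Inst) (c : Test) (h : Store) (p : Prop) : Prop :=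
  ∀ s, Sim I h s → (c.Holds s ↔ p)

theorem satTest_tlt (a a' : Var) (h : Store) : SatTest I (tlt a a') h (h.get a < h.get a') := by
  intro s hs
  simp [tlt, Test.Holds, hs.var]

theorem satTest_teq (a a' : Var) (h : Store) : SatTest I (teq a a') h (h.get a = h.get a') := by
  intro s hs
  simp [teq, Test.Holds, hs.var]

/-- Started in any configuration that represents `h`, the program `p` halts in a configuration
that represents a state satisfying `Post`, whose clock accounts for the steps made. -/
def Sat (I : Inst) (p : Prog) (h : Store) (Post : Store → Prop) : Prop :=
  ∀ s, Sim I h s → ∃ s' t h', Exec I.b p s s' t ∧ Sim I h' s' ∧ h.clk + t ≤ h'.clk ∧ Post h'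

section rules

variable {h : Store} {Post : Store → Prop}

theorem sat_seq {p q : Prog} (hp : Sat I p h fun h' => Sat I q h' Post) :
    Sat I (p ⨾ q) h Post := by
  intro s hs
  obtain ⟨s', t, h', h1, h2, h3, h4⟩ := hp s hs
  obtain ⟨s'', t', h'', k1, k2, k3, k4⟩ := h4 s' h2
  exact ⟨s'', _, h'', .seq h1 k1, k2, by omega, k4⟩

theorem sat_skip (hp : Post (h.tick 1)) : Sat I .skip h Post := fun s hs =>
  ⟨s, 1, _, .skip s, hs.tick 1, le_rfl, hp⟩

theorem Store.clk_set (h : Store) (d : Var) (e : ℕ) : (h.set d e).clk = h.clk := by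
  cases d <;> rfl

theorem Store.clk_setA (h : Store) (r : Arr) (e : ℕ → ℕ) : (h.setA r e).clk = h.clk := by
  cases r <;> rfl

theorem sat_assign {d : Var} {e : ℕ} (he : e ≤ 1) (hp : Post ((h.set d e).tick 1)) :
    Sat I (assign d e) h Post := by
  intro s hs
  have he' : e ≤ I.bd := by unfold Inst.bd; omega
  exact ⟨_, 1, _, exec_setReg rfl (I.lt_word_of_le_bd he'), (hs.set d he').tick 1,
    by simp [Store.tick, Store.clk_set], hp⟩

theorem sat_move {d a : Var} (hp : Post ((h.set d (h.get a)).tick 1)) :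
    Sat I (move d a) h Post := by
  intro s hs
  have he' := hs.var_le a
  refine ⟨_, 1, _, exec_setReg rfl ?_, ?_,
    by simp [Store.tick, Store.clk_set], hp⟩
  · rw [hs.var]; exact I.lt_word_of_le_bd he'
  · rw [hs.var]; exact (hs.set d he').tick 1

theorem sat_plus {d a a' : Var} (he : h.get a + h.get a' ≤ I.bd)
    (hp : Post ((h.set d (h.get a + h.get a')).tick 1)) :
    Sat I (plus d a a') h Post := by
  intro s hs
  refine ⟨_, 1, _, exec_setReg rfl ?_, ?_,
    by simp [Store.tick, Store.clk_set], hp⟩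
  · rw [hs.var, hs.var]; exact I.lt_word_of_le_bd he
  · rw [hs.var, hs.var]; exact (hs.set d he).tick 1

theorem exec_address {s : State} (hs : Sim I h s) (r : Arr) (i : Var) :
    ∃ s', Exec I.b (address r i) s s' 5 ∧ Sim I h s' ∧
      s'.reg 2 = I.K * I.K + I.N * I.N + 8 * h.get i + r.code := by
  have hi := hs.var_le i
  have hr := r.code_lt
  have hr6 := i.reg_ge
  unfold Inst.bd at hi
  have hB : I.K * I.K + I.N * I.N + 8 * h.get i + r.code < 2 ^ I.b := by
    apply I.lt_word
    nlinarith
  have hs1 := hs.scratch (r := 2) (Or.inl rfl) 8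
  have hs2 := hs1.scratch (r := 2) (Or.inl rfl) (8 * h.get i)
  have hs3 := hs2.scratch (r := 3) (Or.inr rfl) r.code
  have hs4 := hs3.scratch (r := 2) (Or.inl rfl) (8 * h.get i + r.code)
  have hs5 := hs4.scratch (r := 2) (Or.inl rfl)
    (8 * h.get i + r.code + (I.K * I.K + I.N * I.N))
  refine ⟨_, .seq (exec_setReg rfl ?_) (.seq (exec_setReg (d := 2) (e := 8 * h.get i) ?_ ?_)
    (.seq (exec_setReg rfl ?_)
    (.seq (exec_setReg (d := 2) (e := 8 * h.get i + r.code) ?_ ?_)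
      (exec_setReg (d := 2) (e := 8 * h.get i + r.code + (I.K * I.K + I.N * I.N)) ?_ ?_)))),
      hs5, ?_⟩
  · apply I.lt_word; nlinarith
  · have := hs1.var i
    dsimp only at this
    simp only [Instr.step]
    rw [this]; simp
  · omega
  · apply I.lt_word; nlinarith
  · simp [Instr.step]
  · omega
  · have := hs4.reg5
    dsimp only at this
    simp only [Instr.step]
    rw [this]; simp
  · omega
  · simp; omega

theorem sat_fetch {d : Var} {r : Arr} {i : Var}
    (hp : Post ((h.set d (h.getA r (h.get i))).tick 6)) : Sat I (fetch d r i) h Post := by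
  intro s hs
  obtain ⟨s', h1, h2, h3⟩ := exec_address hs r i
  have hle := h2.arr_le r (h.get i)
  refine ⟨_, 6, _, .seq h1 (exec_setReg (d := d.reg) (e := h.getA r (h.get i)) ?_ ?_),
    (h2.set d hle).tick 6, by simp [Store.tick, Store.clk_set], hp⟩
  · simp only [Instr.step]; rw [h3, h2.arr]
  · exact I.lt_word_of_le_bd hle

theorem sat_write {r : Arr} {i e : Var}
    (hp : Post ((h.setA r (Function.update (h.getA r) (h.get i) (h.get e))).tick 6)) :
    Sat I (write r i e) h Post := by
  intro s hs
  obtain ⟨s', h1, h2, h3⟩ := exec_address hs r i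
  have hle := h2.var_le e
  refine ⟨_, 6, _, .seq h1 (.instr rfl), ?_, by simp [Store.tick, Store.clk_setA], hp⟩
  rw [h3, h2.var]
  exact (h2.setA r _ hle).tick 6

open Classical in
theorem sat_fetchQ {d i j : Var} (hi : h.get i < I.K) (hj : h.get j < I.K)
    (hp : Post ((h.set d (if I.qle (h.get i) (h.get j) then 1 else 0)).tick 3)) :
    Sat I (fetchQ d i j) h Post := by
  intro s hs
  have hlt : h.get i * I.K + h.get j < I.K * I.K := by nlinarith
  have hw : I.K * I.K < 2 ^ I.b := by
    apply I.lt_word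
    nlinarith [Nat.zero_le (I.K * I.N), Nat.zero_le (I.N * I.N), Nat.zero_le (I.K * I.K)]
  have hle : (if I.qle (h.get i) (h.get j) then 1 else 0) ≤ I.bd := by
    unfold Inst.bd; split <;> omega
  have hs1 := hs.scratch (r := 2) (Or.inl rfl) (h.get i * I.K)
  have hs2 := hs1.scratch (r := 2) (Or.inl rfl) (h.get i * I.K + h.get j)
  refine ⟨_, _, _, .seq (exec_setReg (d := 2) (e := h.get i * I.K) ?_ ?_)
    (.seq (exec_setReg (d := 2) (e := h.get i * I.K + h.get j) ?_ ?_)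
    (exec_setReg (d := d.reg) (e := if I.qle (h.get i) (h.get j) then 1 else 0) ?_ ?_)),
    (hs2.set d hle).tick 3, by simp [Store.tick, Store.clk_set], hp⟩
  · simp only [Instr.step]; rw [hs.var, hs.reg0]
  · omega
  · have := hs1.var j
    dsimp only at this
    simp only [Instr.step]; rw [this]; simp
  · omega
  · have := hs2.memQ _ hi _ hj
    simp only [Instr.step, Function.update_self]
    rw [this]
  · exact I.lt_word_of_le_bd hle

open Classical in
theorem sat_fetchP {d i j : Var} (hi : h.get i < I.N) (hj : h.get j < I.N)
    (hp : Post ((h.set d (if I.le (h.get i) (h.get j) then 1 else 0)).tick 4)) :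
    Sat I (fetchP d i j) h Post := by
  intro s hs
  have hlt : h.get i * I.N + h.get j < I.N * I.N := by nlinarith
  have hw : I.K * I.K + I.N * I.N < 2 ^ I.b := by apply I.lt_word; nlinarith
  have hle : (if I.le (h.get i) (h.get j) then 1 else 0) ≤ I.bd := by
    unfold Inst.bd; split <;> omega
  have hs1 := hs.scratch (r := 2) (Or.inl rfl) (h.get i * I.N)
  have hs2 := hs1.scratch (r := 2) (Or.inl rfl) (h.get i * I.N + h.get j)
  have hs3 := hs2.scratch (r := 2) (Or.inl rfl) (h.get i * I.N + h.get j + I.K * I.K)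
  refine ⟨_, _, _, .seq (exec_setReg (d := 2) (e := h.get i * I.N) ?_ ?_)
    (.seq (exec_setReg (d := 2) (e := h.get i * I.N + h.get j) ?_ ?_)
    (.seq (exec_setReg (d := 2) (e := h.get i * I.N + h.get j + I.K * I.K) ?_ ?_)
    (exec_setReg (d := d.reg) (e := if I.le (h.get i) (h.get j) then 1 else 0) ?_ ?_))),
    (hs3.set d hle).tick 4, by simp [Store.tick, Store.clk_set], hp⟩
  · simp only [Instr.step]; rw [hs.var, hs.reg1]
  · omega
  · have := hs1.var j
    dsimp only at this
    simp only [Instr.step]; rw [this]; simp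
  · omega
  · have := hs2.reg4
    dsimp only at this
    simp only [Instr.step]; rw [this]; simp
  · omega
  · have := hs3.memP _ hi _ hj
    simp only [Instr.step, Function.update_self]
    rw [show h.get i * I.N + h.get j + I.K * I.K = I.K * I.K + h.get i * I.N + h.get j by ring]
    rw [this]
  · exact I.lt_word_of_le_bd hle

theorem sat_ite {c : Test} {p q : Prog} {P : Prop} (hc : SatTest I c h P)
    (hp : P → Sat I p (h.tick 1) Post) (hq : ¬ P → Sat I q (h.tick 1) Post) :
    Sat I (.ite c p q) h Post := by
  intro s hs
  by_cases hP : P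
  · obtain ⟨s', t, h', h1, h2, h3, h4⟩ := hp hP s (hs.tick 1)
    exact ⟨s', _, h', .ite_true ((hc s hs).2 hP) h1, h2, by simp [Store.tick] at h3; omega, h4⟩
  · obtain ⟨s', t, h', h1, h2, h3, h4⟩ := hq hP s (hs.tick 1)
    exact ⟨s', _, h', .ite_false (fun h => hP ((hc s hs).1 h)) h1, h2,
      by simp [Store.tick] at h3; omega, h4⟩

/-- Rule for loops: `J r` is the invariant when at most `r` rounds remain, and each round takes at
most `e` steps. -/
theorem sat_loop {c : Test} {p : Prog} {P : Store → Prop} (J : ℕ → Store → Prop) (e : ℕ)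
    (hc : ∀ h, SatTest I c h (P h)) (r : ℕ) (h0 : J r h)
    (hbody : ∀ r h, J r h → P h →
      Sat I p (h.tick 1) fun h' => ∃ r' < r, J r' h' ∧ h'.clk ≤ h.clk + e)
    (hexit : ∀ r' h', J r' h' → ¬ P h' → h'.clk ≤ h.clk + r * e → Post (h'.tick 1)) :
    Sat I (.loop c p) h Post := by
  -- The counter may drop by more than one: rounds that end a search set it to 0 at once. The budget
  -- still suffices because (r' + 1)e ≤ re.
  induction r using Nat.strong_induction_on generalizing h with
  | _ r ih =>
    intro s hs
    by_cases hP : P h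
    · obtain ⟨s', t, h', h1, h2, h3, r', hr', hJ, hclk⟩ := hbody r h h0 hP s (hs.tick 1)
      have hmul : (r' + 1) * e ≤ r * e := Nat.mul_le_mul_right e hr'
      have hring : (r' + 1) * e = r' * e + e := by ring
      obtain ⟨s'', t', h'', k1, k2, k3, k4⟩ := ih r' hr' hJ
        (fun r'' h'' a1 a2 a3 => hexit r'' h'' a1 a2 (by omega)) s' h2
      refine ⟨s'', _, h'', .loop_step ((hc h s hs).2 hP) h1 k1, k2, ?_, k4⟩
      simp only [Store.tick] at h3
      omega
    · exact ⟨s, 1, _, .loop_done (fun h' => hP ((hc h s hs).1 h')), hs.tick 1, le_rfl,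
        hexit r h h0 hP (by omega)⟩

end rules

/-! ### Listing the bottoms of chains and placing pointers -/

/-- The elements below `X` without a predecessor. -/
def bottoms (N : ℕ) (prd : ℕ → ℕ) (X : ℕ) : Finset ℕ := {y ∈ Finset.range X | prd y = N}

theorem mem_bottoms {N : ℕ} {prd : ℕ → ℕ} {X y : ℕ} :
    y ∈ bottoms N prd X ↔ y < X ∧ prd y = N := by
  simp [bottoms]

theorem bottoms_succ {N : ℕ} {prd : ℕ → ℕ} {X : ℕ} :
    (bottoms N prd (X + 1)).card = (bottoms N prd X).card + if prd X = N then 1 else 0 := by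
  unfold bottoms
  rw [Finset.range_add_one, Finset.filter_insert]
  split_ifs <;> simp

/-- The list `bot 0, …, bot (m - 1)` enumerates the elements below `X` without a predecessor. -/
structure Listed (N : ℕ) (prd : ℕ → ℕ) (X m : ℕ) (bot : ℕ → ℕ) : Prop where
  card : m = (bottoms N prd X).card
  lt : ∀ q < m, bot q < X
  bottom : ∀ q < m, prd (bot q) = N
  inj : ∀ q < m, ∀ q' < m, bot q = bot q' → q = q'
  surj : ∀ y < X, prd y = N → ∃ q < m, bot q = y

theorem listed_zero (N : ℕ) (prd bot : ℕ → ℕ) : Listed N prd 0 0 bot :=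
  ⟨by simp [bottoms], by simp, by simp, by simp, by simp⟩

theorem Listed.push {N : ℕ} {prd : ℕ → ℕ} {X m : ℕ} {bot : ℕ → ℕ} (hL : Listed N prd X m bot)
    (hX : prd X = N) : Listed N prd (X + 1) (m + 1) (Function.update bot m X) := by
  obtain ⟨h1, h2, h3, h4, h5⟩ := hL
  refine ⟨by rw [bottoms_succ, if_pos hX, h1], ?_, ?_, ?_, ?_⟩
  · intro q hq; grind
  · intro q hq; grind
  · intro q hq q' hq'; grind
  · intro y hy hy'
    by_cases hyX : y = X
    · exact ⟨m, by omega, by simp [hyX]⟩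
    · obtain ⟨q, hq, rfl⟩ := h5 y (by omega) hy'
      exact ⟨q, by omega, by rw [Function.update_of_ne (by omega)]⟩

theorem Listed.pass {N : ℕ} {prd : ℕ → ℕ} {X m : ℕ} {bot : ℕ → ℕ} (hL : Listed N prd X m bot)
    (hX : prd X ≠ N) : Listed N prd (X + 1) m bot := by
  obtain ⟨h1, h2, h3, h4, h5⟩ := hL
  refine ⟨by rw [bottoms_succ, if_neg hX, h1, Nat.add_zero], ?_, h3, h4, ?_⟩
  · intro q hq; have := h2 q hq; omega
  · intro y hy hy'
    exact h5 y (by grind) hy'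

/-- List the bottoms of the chains on the elements below `lim`. -/
def collect : Prog :=
  assign .m 0 ⨾ assign .i 0 ⨾ .loop (tlt .i .lim)
    (fetch .t .prd .i ⨾
      .ite (teq .t .n) (write .bot .m .i ⨾ write .dig .m .m ⨾ plus .m .m .one) .skip ⨾
      plus .i .i .one)

/-- The continuation `hp` quantifies only over the fields that change, so that all others visibly
persist. The identity digits make a following `reset` put pointer q at bottom q. -/
theorem sat_collect {h : Store} {Post : Store → Prop} (hn : h.n = I.N) (h1 : h.one = 1)
    (hl : h.lim ≤ I.N)
    (hp : ∀ m i t bot dig clk, Listed I.N h.prd h.lim m bot → (∀ q < m, dig q = q) →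
      clk ≤ h.clk + 30 * h.lim + 3 →
      Post { h with m := m, i := i, t := t, bot := bot, dig := dig, clk := clk }) :
    Sat I collect h Post := by
  refine sat_seq (sat_assign (by omega) (sat_seq (sat_assign (by omega) ?_)))
  refine sat_loop (P := fun h' => h'.i < h'.lim)
    (fun r h' => ∃ m i t bot dig clk, h' =
      { h with m := m, i := i, t := t, bot := bot, dig := dig, clk := clk } ∧ r + i = h.lim ∧
      m ≤ i ∧ Listed I.N h.prd i m bot ∧ ∀ q < m, dig q = q) 30
    (fun h' => satTest_tlt _ _ h') h.lim
    ⟨0, 0, h.t, h.bot, h.dig, _, rfl, by omega, le_rfl, listed_zero _ _ _, by simp⟩ ?_ ?_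
  · rintro r _ ⟨m, i, t, bot, dig, clk, rfl, hr, hm, hL, hd⟩ hlt
    dsimp only at hlt
    refine sat_seq (sat_fetch (sat_seq (sat_ite (satTest_teq _ _ _) ?_ ?_)))
    · intro ht
      replace ht : h.prd i = I.N := ht.trans hn
      refine sat_seq (sat_write (sat_seq (sat_write (sat_plus ?_ (sat_plus ?_ ?_)))))
      · simp only [Store.tick, Store.set, Store.setA, Store.get, Inst.bd]; omega
      · simp only [Store.tick, Store.set, Store.setA, Store.get, Inst.bd]; omega
      · dsimp only [Store.tick, Store.set, Store.setA, Store.get, Store.getA]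
        refine ⟨h.lim - (i + 1), by omega, ⟨m + 1, i + 1, h.prd i, Function.update bot m i,
          Function.update dig m m, _, by rw [h1], by omega, by omega, hL.push ht, ?_⟩, by omega⟩
        intro q hq; grind
    · intro ht
      replace ht : h.prd i ≠ I.N := fun h' => ht (h'.trans hn.symm)
      refine sat_skip (sat_plus ?_ ?_)
      · simp only [Store.tick, Store.set, Store.setA, Store.get, Inst.bd]; omega
      · dsimp only [Store.tick, Store.set, Store.setA, Store.get, Store.getA]
        exact ⟨h.lim - (i + 1), by omega, ⟨m, i + 1, h.prd i, bot,
          dig, _, by rw [h1], by omega, by omega, hL.pass ht, hd⟩, by omega⟩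
  · rintro r _ ⟨m, i, t, bot, dig, clk, rfl, hr, hm, hL, hd⟩ hlt hclk
    dsimp only [Store.tick, Store.set] at hlt hclk ⊢
    have : i = h.lim := by omega
    subst this
    exact hp _ _ _ _ _ _ hL hd (by omega)

/-- Set the first `l` pointers to the bottoms of the chains named by the digits. -/
def reset : Prog :=
  assign .i 0 ⨾ .loop (tlt .i .l)
    (fetch .t .dig .i ⨾ fetch .t .bot .t ⨾ write .ptr .i .t ⨾ plus .i .i .one)

theorem sat_reset {h : Store} {Post : Store → Prop} (h1 : h.one = 1) (hl : h.l ≤ I.K + I.N)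
    (hp : ∀ i t ptr clk, (∀ q < h.l, ptr q = h.bot (h.dig q)) → clk ≤ h.clk + 20 * h.l + 2 →
      Post { h with i := i, t := t, ptr := ptr, clk := clk }) :
    Sat I reset h Post := by
  refine sat_seq (sat_assign (by omega) ?_)
  refine sat_loop (P := fun h' => h'.i < h'.l)
    (fun r h' => ∃ i t ptr clk, h' = { h with i := i, t := t, ptr := ptr, clk := clk } ∧
      r + i = h.l ∧ ∀ q < i, ptr q = h.bot (h.dig q)) 20
    (fun h' => satTest_tlt _ _ h') h.l
    ⟨0, h.t, h.ptr, _, rfl, by omega, by simp⟩ ?_ ?_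
  · rintro r _ ⟨i, t, ptr, clk, rfl, hr, hptr⟩ hlt
    dsimp only at hlt
    refine sat_seq (sat_fetch (sat_seq (sat_fetch (sat_seq (sat_write (sat_plus ?_ ?_))))))
    · simp only [Store.tick, Store.set, Store.setA, Store.get, Inst.bd]; omega
    · dsimp only [Store.tick, Store.set, Store.setA, Store.get, Store.getA]
      refine ⟨h.l - (i + 1), by omega, ⟨i + 1, _, _, _, by rw [h1], by omega, ?_⟩, by omega⟩
      intro q hq
      grind
  · rintro r _ ⟨i, t, ptr, clk, rfl, hr, hptr⟩ hlt hclk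
    dsimp only [Store.tick, Store.set] at hlt hclk ⊢
    exact hp _ _ _ _ (fun q hq => hptr q (by omega)) (by omega)

/-! ### Scanning pairs of pointers for a mismatch -/

/-- Look for a pair of pointers for which the order of the pointers differs from the prescribed
relation; `rel` computes this relation. The pointer with index `v` has to be advanced. -/
def scan (rel : Prog) : Prog :=
  assign .f 0 ⨾ assign .i 0 ⨾ .loop (tlt .i .l)
    (assign .j 0 ⨾ .loop (tlt .j .l)
      (rel ⨾ fetch .t .ptr .i ⨾ fetch .u .ptr .j ⨾ fetchP .c .t .u ⨾
        .ite (tlt .a .c) (assign .f 1 ⨾ move .v .i ⨾ move .w .j)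
          (.ite (tlt .c .a) (assign .f 1 ⨾ move .v .j ⨾ move .w .i) .skip) ⨾
        plus .j .j .one) ⨾
      plus .i .i .one)

/-- Advancing the pointer `v` is forced by the pair `v`, `w`. -/
def Forced (I : Inst) (R : ℕ → ℕ → Prop) (l : ℕ) (ptr : ℕ → ℕ) (v w : ℕ) : Prop :=
  v < l ∧ w < l ∧ ((¬ R v w ∧ I.le (ptr v) (ptr w)) ∨ (R w v ∧ ¬ I.le (ptr w) (ptr v)))

open Classical in
-- Any mismatch serves, so a later one may overwrite an earlier one and no early exit is needed. If
-- the pointers are ordered but the relation fails, `i` is to blame; in the opposite case, `j`.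
theorem sat_scan {rel : Prog} {R : ℕ → ℕ → Prop} {h : Store} {Post : Store → Prop}
    (h1 : h.one = 1) (hl : h.l ≤ I.K + I.N) (hptr : ∀ q < h.l, h.ptr q < I.N)
    (hrel : ∀ h' : Store, h'.i < h.l → h'.j < h.l → ∀ Post' : Store → Prop,
      (∀ clk, clk ≤ h'.clk + 3 →
        Post' { h' with a := if R h'.i h'.j then 1 else 0, clk := clk }) → Sat I rel h' Post')
    (hp : ∀ f i j a t u c v w clk, clk ≤ h.clk + 40 * (h.l + 1) ^ 2 →
      (f = 0 ∧ (∀ q < h.l, ∀ q' < h.l, R q q' ↔ I.le (h.ptr q) (h.ptr q')) ∨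
        f = 1 ∧ Forced I R h.l h.ptr v w) →
      Post { h with f := f, i := i, j := j, a := a, t := t, u := u, c := c, v := v, w := w,
                    clk := clk }) :
    Sat I (scan rel) h Post := by
  refine sat_seq (sat_assign (by omega) (sat_seq (sat_assign (by omega) ?_)))
  refine sat_loop (P := fun h' => h'.i < h'.l)
    (fun r h' => ∃ f i j a t u c v w clk, h' =
      { h with f := f, i := i, j := j, a := a, t := t, u := u, c := c, v := v, w := w,
               clk := clk } ∧ r + i = h.l ∧
      (f = 0 ∧ (∀ q < i, ∀ q' < h.l, R q q' ↔ I.le (h.ptr q) (h.ptr q')) ∨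
        f = 1 ∧ Forced I R h.l h.ptr v w)) (h.l * 32 + 5)
    (fun h' => satTest_tlt _ _ h') h.l
    ⟨0, 0, h.j, h.a, h.t, h.u, h.c, h.v, h.w, _, rfl, by omega, Or.inl ⟨rfl, by simp⟩⟩ ?_ ?_
  · rintro r _ ⟨f, i, j, a, t, u, c, v, w, clk, rfl, hr, hf⟩ hlt
    dsimp only at hlt
    refine sat_seq (sat_assign (by omega) (sat_seq ?_))
    refine sat_loop (P := fun h' => h'.j < h'.l)
      (fun r h' => ∃ f j a t u c v w clk, h' =
        { h with f := f, i := i, j := j, a := a, t := t, u := u, c := c, v := v, w := w,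
                 clk := clk } ∧ r + j = h.l ∧
        (f = 0 ∧ (∀ q < i, ∀ q' < h.l, R q q' ↔ I.le (h.ptr q) (h.ptr q')) ∧
          (∀ q' < j, R i q' ↔ I.le (h.ptr i) (h.ptr q')) ∨
          f = 1 ∧ Forced I R h.l h.ptr v w)) 32
      (fun h' => satTest_tlt _ _ h') h.l
      ⟨f, 0, a, t, u, c, v, w, _, rfl, by omega, ?_⟩ ?_ ?_
    · rcases hf with hf | hf
      · exact Or.inl ⟨hf.1, hf.2, by simp⟩
      · exact Or.inr hf
    · clear hf
      rintro r _ ⟨f, j, a, t, u, c, v, w, clk, rfl, hr, hf⟩ hlt'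
      dsimp only at hlt'
      refine sat_seq (hrel _ hlt hlt' _ fun clk' hclk' => ?_)
      dsimp only [Store.tick] at hclk' ⊢
      refine sat_seq (sat_fetch (sat_seq (sat_fetch (sat_seq (sat_fetchP (hptr i hlt)
        (hptr j hlt') (sat_seq (sat_ite (satTest_tlt _ _ _) ?_ ?_)))))))
      · intro hac
        dsimp only [Store.tick, Store.set, Store.setA, Store.get, Store.getA] at hac ⊢
        refine sat_seq (sat_assign le_rfl (sat_seq (sat_move (sat_move (sat_plus ?_ ?_)))))
        · simp only [Store.tick, Store.set, Store.setA, Store.get, Inst.bd]; omega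
        · dsimp only [Store.tick, Store.set, Store.setA, Store.get, Store.getA]
          refine ⟨h.l - (j + 1), by omega, ⟨_, _, _, _, _, _, _, _, _, by rw [h1], by omega,
            Or.inr ⟨rfl, hlt, hlt', Or.inl ?_⟩⟩, by omega⟩
          grind
      · intro hac
        refine sat_ite (satTest_tlt _ _ _) ?_ ?_
        · intro hca
          dsimp only [Store.tick, Store.set, Store.setA, Store.get, Store.getA] at hac hca ⊢
          refine sat_seq (sat_assign le_rfl (sat_seq (sat_move (sat_move (sat_plus ?_ ?_)))))
          · simp only [Store.tick, Store.set, Store.setA, Store.get, Inst.bd]; omega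
          · dsimp only [Store.tick, Store.set, Store.setA, Store.get, Store.getA]
            refine ⟨h.l - (j + 1), by omega, ⟨_, _, _, _, _, _, _, _, _, by rw [h1], by omega,
              Or.inr ⟨rfl, hlt', hlt, Or.inr ?_⟩⟩, by omega⟩
            grind
        · intro hca
          dsimp only [Store.tick, Store.set, Store.setA, Store.get, Store.getA] at hac hca ⊢
          refine sat_skip (sat_plus ?_ ?_)
          · simp only [Store.tick, Store.set, Store.setA, Store.get, Inst.bd]; omega
          · dsimp only [Store.tick, Store.set, Store.setA, Store.get, Store.getA]
            refine ⟨h.l - (j + 1), by omega, ⟨_, _, _, _, _, _, _, _, _, by rw [h1], by omega,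
              ?_⟩, by omega⟩
            rcases hf with ⟨hf0, hf1, hf2⟩ | hf
            · refine Or.inl ⟨hf0, hf1, fun q' hq' => ?_⟩
              by_cases hqj : q' = j
              · subst hqj
                by_cases hR : R i q' <;> by_cases hle : I.le (h.ptr i) (h.ptr q') <;>
                  simp_all
              · exact hf2 q' (by omega)
            · exact Or.inr hf
    · clear hf
      rintro r _ ⟨f, j, a, t, u, c, v, w, clk, rfl, hr, hf⟩ hlt' hclk
      dsimp only [Store.tick, Store.set, Store.setA, Store.get, Store.getA] at hlt' hclk ⊢
      refine sat_plus ?_ ?_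
      · simp only [Store.get, Inst.bd]; omega
      · dsimp only [Store.tick, Store.set, Store.setA, Store.get, Store.getA]
        refine ⟨h.l - (i + 1), by omega, ⟨_, _, _, _, _, _, _, _, _, _, by rw [h1], by omega,
          ?_⟩, by omega⟩
        rcases hf with ⟨hf0, hf1, hf2⟩ | hf
        · refine Or.inl ⟨hf0, fun q hq q' hq' => ?_⟩
          by_cases hqi : q = i
          · subst hqi; exact hf2 q' (by omega)
          · exact hf1 q (by omega) q' hq'
        · exact Or.inr hf
  · rintro r _ ⟨f, i, j, a, t, u, c, v, w, clk, rfl, hr, hf⟩ hlt hclk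
    dsimp only [Store.tick, Store.set] at hlt hclk ⊢
    refine hp _ _ _ _ _ _ _ _ _ _ (by nlinarith) ?_
    rcases hf with hf | hf
    · exact Or.inl ⟨hf.1, fun q hq => hf.2 q (by omega)⟩
    · exact Or.inr hf

/-! ### Chain partitions and relinking -/

/-- The arrays `prd` and `nxt` describe a partition of the elements below `X` into chains by
predecessor and successor links, where `N` stands for no link; the successor link of `u` is
invalid and `u` is considered as the top of its chain. -/
structure Links (I : Inst) (prd nxt : ℕ → ℕ) (X u : ℕ) : Prop where
  of_prd : ∀ y < X, prd y = I.N ∨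
    (prd y < X ∧ prd y ≠ u ∧ nxt (prd y) = y ∧ I.le (prd y) y ∧ prd y ≠ y)
  of_nxt : ∀ z < X, z ≠ u → nxt z = I.N ∨ (nxt z < X ∧ prd (nxt z) = z)

theorem Links.insert {prd nxt : ℕ → ℕ} {X : ℕ} (hL : Links I prd nxt X I.N) :
    Links I (Function.update prd X I.N) (Function.update nxt X I.N) (X + 1) I.N := by
  obtain ⟨h1, h2⟩ := hL
  constructor
  · intro y hy
    by_cases hyX : y = X
    · left; simp [hyX]
    · rcases h1 y (by omega) with h | ⟨a1, a2, a3, a4, a5⟩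
      · left; rwa [Function.update_of_ne hyX]
      · right
        rw [Function.update_of_ne hyX, Function.update_of_ne (by omega)]
        exact ⟨by omega, a2, a3, a4, a5⟩
  · intro z hz hzN
    by_cases hzX : z = X
    · left; simp [hzX]
    · rcases h2 z (by omega) hzN with h | ⟨a1, a2⟩
      · left; rwa [Function.update_of_ne hzX]
      · right
        rw [Function.update_of_ne hzX, Function.update_of_ne (by omega)]
        exact ⟨by omega, a2⟩

theorem card_bottoms_insert {N : ℕ} {prd : ℕ → ℕ} {X : ℕ} :
    (bottoms N (Function.update prd X N) (X + 1)).card = (bottoms N prd X).card + 1 := by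
  rw [bottoms_succ, if_pos (by simp)]
  congr 2
  ext y
  simp only [mem_bottoms]
  refine and_congr_right fun hy => ?_
  rw [Function.update_of_ne (by omega)]

/-- If `u` were the predecessor of some y < X, its successor link would be y, which is not `I.N`. -/
theorem Links.dangling {prd nxt : ℕ → ℕ} {X u : ℕ} (hX : X ≤ I.N) (hL : Links I prd nxt X I.N)
    (hnu : nxt u = I.N) : Links I prd nxt X u := by
  obtain ⟨h1, h2⟩ := hL
  refine ⟨fun y hy => (h1 y hy).imp_right ?_, fun z hz hzu => h2 z hz (by omega)⟩
  rintro ⟨a1, a2, a3, a4, a5⟩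
  refine ⟨a1, ?_, a3, a4, a5⟩
  rintro rfl
  omega

/-- Once `y` hangs above `u`, the former predecessor of `y` loses its successor and is the new
dangling top. If `y` was a bottom, this is `I.N`: no dangling top remains. -/
theorem Links.relink {prd nxt : ℕ → ℕ} {X u y : ℕ} (hX : X ≤ I.N) (hL : Links I prd nxt X u)
    (hu : u < X) (hy : y < X) (hle : I.le u y) (hne : u ≠ y) :
    Links I (Function.update prd y u) (Function.update nxt u y) X (prd y) := by
  obtain ⟨h1, h2⟩ := hL
  have hyp := h1 y hy
  constructor
  · intro z hz
    have := h1 z hz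
    by_cases hzy : z = y
    · subst hzy
      right
      simp only [Function.update_self]
      exact ⟨hu, by rcases hyp with h | h <;> omega, trivial, hle, hne⟩
    · rw [Function.update_of_ne hzy]
      rcases this with h | ⟨a1, a2, a3, a4, a5⟩
      · exact Or.inl h
      · right
        rw [Function.update_of_ne a2]
        refine ⟨a1, ?_, a3, a4, a5⟩
        intro heq
        rcases hyp with h | h
        · omega
        · rw [heq] at a3; omega
  · intro z hz hzy
    by_cases hzu : z = u
    · subst hzu; right; simp [hy]
    · rw [Function.update_of_ne hzu]
      refine (h2 z hz hzu).imp_right ?_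
      rintro ⟨a1, a2⟩
      refine ⟨a1, ?_⟩
      rw [Function.update_of_ne]
      · exact a2
      · rintro rfl; exact hzy a2.symm

theorem card_bottoms_relink {N : ℕ} {prd : ℕ → ℕ} {X y u : ℕ} (hy : y < X) (hu : u ≠ N) :
    (bottoms N (Function.update prd y u) X).card + (if prd y = N then 1 else 0) =
      (bottoms N prd X).card := by
  have h : bottoms N (Function.update prd y u) X = (bottoms N prd X).erase y := by
    ext z
    simp only [mem_bottoms, Finset.mem_erase]
    by_cases hzy : z = y
    · subst hzy; simp [hu]
    · simp [hzy]
  rw [h]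
  split_ifs with hp
  · exact Finset.card_erase_add_one (mem_bottoms.2 ⟨hy, hp⟩)
  · rw [Finset.erase_eq_of_notMem (fun h => hp (mem_bottoms.1 h).2), Nat.add_zero]

/-! ### Witness lists and removal of a chain -/

/-- The elements of the list are distinct, and each has a larger witness whose predecessor occurs
later in the list. -/
def Good (I : Inst) (prd wit : ℕ → ℕ) (X : ℕ) : List ℕ → Prop
  | [] => True
  | z :: L => z < X ∧ z ∉ L ∧ wit z < X ∧ I.le z (wit z) ∧ z ≠ wit z ∧
      (prd (wit z) = I.N ∨ prd (wit z) ∈ L) ∧ Good I prd wit X L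

theorem Good.lt {prd wit : ℕ → ℕ} {X : ℕ} {L : List ℕ} (hL : Good I prd wit X L) :
    ∀ z ∈ L, z < X := by
  induction L with
  | nil => simp
  | cons a L ih =>
    obtain ⟨h1, -, -, -, -, -, h2⟩ := hL
    simpa using ⟨h1, ih h2⟩

theorem Good.nodup {prd wit : ℕ → ℕ} {X : ℕ} {L : List ℕ} (hL : Good I prd wit X L) :
    L.Nodup := by
  induction L with
  | nil => simp
  | cons a L ih =>
    obtain ⟨-, h1, -, -, -, -, h2⟩ := hL
    exact List.nodup_cons.2 ⟨h1, ih h2⟩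

/-- Bounds both the number of pointer moves and the number of reroutings. -/
theorem Good.length_le {prd wit : ℕ → ℕ} {X : ℕ} {L : List ℕ} (hL : Good I prd wit X L) :
    L.length ≤ X := by
  rw [← List.toFinset_card_of_nodup hL.nodup]
  calc L.toFinset.card ≤ (Finset.range X).card :=
        Finset.card_le_card fun z hz => by simpa using hL.lt z (by simpa using hz)
    _ = X := Finset.card_range X

theorem Good.update_wit {prd wit : ℕ → ℕ} {X u y : ℕ} {L : List ℕ} (hL : Good I prd wit X L)
    (hu : u ∉ L) : Good I prd (Function.update wit u y) X L := by
  induction L with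
  | nil => trivial
  | cons a L ih =>
    obtain ⟨h1, h2, h3, h4, h5, h6, h7⟩ := hL
    have hau : a ≠ u := by rintro rfl; simp at hu
    have huL : u ∉ L := fun h => hu (by simp [h])
    refine ⟨h1, h2, ?_, ?_, ?_, ?_, ih h7 huL⟩ <;> rwa [Function.update_of_ne hau]

/-- No element of the list can have `y` as witness, since `prd y` would then have to be `I.N` or
occur in the tail. So relinking `y` affects none of the recorded conditions. -/
theorem Good.update_prd {prd wit : ℕ → ℕ} {X u y : ℕ} {L : List ℕ} (hL : Good I prd wit X L)
    (hy : prd y ∉ L.tail) (hN : prd y ≠ I.N) : Good I (Function.update prd y u) wit X L := by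
  induction L with
  | nil => trivial
  | cons a L ih =>
    obtain ⟨h1, h2, h3, h4, h5, h6, h7⟩ := hL
    have hy' : prd y ∉ L := hy
    refine ⟨h1, h2, h3, h4, h5, ?_, ih h7 fun h => hy' (List.mem_of_mem_tail h)⟩
    rwa [Function.update_of_ne]
    rintro rfl
    tauto

/-- Rerouting jumps to an element passed earlier and forgets everything passed after it; the shorter
list gives termination. -/
theorem Good.suffix {prd wit : ℕ → ℕ} {X z : ℕ} {L : List ℕ} (hL : Good I prd wit X L)
    (hz : z ∈ L) : ∃ L', Good I prd wit X (z :: L') ∧ L'.length < L.length := by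
  induction L with
  | nil => simp at hz
  | cons a L ih =>
    by_cases haz : z = a
    · subst haz; exact ⟨L, hL, by simp⟩
    · obtain ⟨L', h1, h2⟩ := ih hL.2.2.2.2.2.2 (by simpa [haz] using hz)
      exact ⟨L', h1, by simp; omega⟩

/-- Reduce the number of chains by one, starting from the top `u` of a chain. -/
def augment : Prog :=
  .loop (tlt .u .n)
    (fetch .y .wit .u ⨾ fetch .t .prd .y ⨾ write .prd .y .u ⨾ write .nxt .u .y ⨾ move .u .t)

/-- Each relinking preserves the number of bottoms as long as the witness has a predecessor; the
last one turns a bottom into an inner element, which lowers the number by one. -/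
theorem sat_augment {h : Store} {Post : Store → Prop} {X : ℕ} {L : List ℕ} (hn : h.n = I.N)
    (hX : X ≤ I.N) (hL : Good I h.prd h.wit X (h.u :: L)) (hlinks : Links I h.prd h.nxt X h.u)
    (hp : ∀ y t u prd nxt clk, Links I prd nxt X I.N →
      (bottoms I.N prd X).card + 1 = (bottoms I.N h.prd X).card → clk ≤ h.clk + 26 * X + 1 →
      Post { h with y := y, t := t, u := u, prd := prd, nxt := nxt, clk := clk }) :
    Sat I augment h Post := by
  refine sat_loop (P := fun h' => h'.u < h'.n)
    (fun r h' => ∃ y t u prd nxt clk,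
      h' = { h with y := y, t := t, u := u, prd := prd, nxt := nxt, clk := clk } ∧
      Links I prd nxt X u ∧
      ((u = I.N ∧ (bottoms I.N prd X).card + 1 = (bottoms I.N h.prd X).card) ∨
        ∃ L, L.length < r ∧ Good I prd h.wit X (u :: L) ∧
          (bottoms I.N prd X).card = (bottoms I.N h.prd X).card)) 26
    (fun h' => satTest_tlt _ _ h') (L.length + 1)
    ⟨h.y, h.t, h.u, h.prd, h.nxt, h.clk, rfl, hlinks, Or.inr ⟨L, by omega, hL, rfl⟩⟩ ?_ ?_
  · rintro r _ ⟨y, t, u, prd, nxt, clk, rfl, hl, hcase⟩ hlt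
    dsimp only at hlt
    rcases hcase with ⟨hu, -⟩ | ⟨L, hr, hG, hcard⟩
    · omega
    refine sat_seq (sat_fetch (sat_seq (sat_fetch (sat_seq (sat_write (sat_seq (sat_write
      (sat_move ?_))))))))
    dsimp only [Store.tick, Store.set, Store.setA, Store.get, Store.getA]
    obtain ⟨h1, h2, h3, h4, h5, h6, h7⟩ := hG
    have hrel := hl.relink hX h1 h3 h4 h5
    have hcb := card_bottoms_relink (N := I.N) (prd := prd) (u := u) h3 (by omega)
    rcases h6 with h6 | h6
    · refine ⟨0, by omega, ⟨_, _, _, _, _, _, rfl, hrel, Or.inl ⟨h6, ?_⟩⟩, by omega⟩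
      rw [if_pos h6] at hcb
      omega
    · have hltN := h7.lt _ h6
      obtain ⟨L', hG', hlen⟩ := h7.suffix h6
      refine ⟨L'.length + 1, by omega, ⟨_, _, _, _, _, _, rfl, hrel, Or.inr ⟨L', by omega,
        hG'.update_prd hG'.2.1 (by omega), ?_⟩⟩, by omega⟩
      rw [if_neg (by omega)] at hcb
      omega
  · rintro r _ ⟨y, t, u, prd, nxt, clk, rfl, hl, hcase⟩ hlt hclk
    dsimp only [Store.tick] at hlt hclk ⊢
    rcases hcase with ⟨hu, hcard⟩ | ⟨L', hr, hG, hcard⟩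
    · subst hu
      have := hL.length_le
      simp only [List.length_cons] at this
      exact hp _ _ _ _ _ _ hl hcard (by omega)
    · have := hG.1
      omega

/-! ### Search for an antichain or for a top to be passed -/

/-- Invariant of the search for a comparable pair among the pointers: `L` is the list of elements
that have been passed by a pointer. -/
structure Search (I : Inst) (prd wit : ℕ → ℕ) (X m : ℕ) (ptr : ℕ → ℕ) (L : List ℕ) : Prop where
  lt : ∀ q < m, ptr q < X
  inj : ∀ q < m, ∀ q' < m, ptr q = ptr q' → q = q'
  fresh : ∀ q < m, ptr q ∉ L
  low : ∀ q < m, prd (ptr q) = I.N ∨ prd (ptr q) ∈ L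
  closed : ∀ z ∈ L, prd z = I.N ∨ prd z ∈ L
  good : Good I prd wit X L

/-- The witness is a current pointer, so everything directly below it has already been passed. This
is what lets the rerouting continue. -/
theorem Search.good_cons {prd wit : ℕ → ℕ} {X m : ℕ} {ptr : ℕ → ℕ} {L : List ℕ}
    (hS : Search I prd wit X m ptr L) {v w : ℕ} (hv : v < m) (hw : w < m) (hvw : v ≠ w)
    (hle : I.le (ptr v) (ptr w)) :
    Good I prd (Function.update wit (ptr v) (ptr w)) X (ptr v :: L) := by
  refine ⟨hS.lt v hv, hS.fresh v hv, ?_, ?_, ?_, ?_, hS.good.update_wit (hS.fresh v hv)⟩ <;>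
    rw [Function.update_self]
  · exact hS.lt w hw
  · exact hle
  · exact fun h => hvw (hS.inj v hv w hw h)
  · exact hS.low w hw

/-- Chains are not recorded explicitly. If the next element were another pointer or already passed,
its predecessor `ptr v` would lie in `L`, contradicting freshness. -/
theorem Search.advance {prd wit nxt : ℕ → ℕ} {X m : ℕ} {ptr : ℕ → ℕ} {L : List ℕ}
    (hX : X ≤ I.N) (hS : Search I prd wit X m ptr L) (hl : Links I prd nxt X I.N) {v w : ℕ}
    (hv : v < m) (hw : w < m) (hvw : v ≠ w) (hle : I.le (ptr v) (ptr w))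
    (hN : nxt (ptr v) ≠ I.N) :
    Search I prd (Function.update wit (ptr v) (ptr w)) X m
      (Function.update ptr v (nxt (ptr v))) (ptr v :: L) := by
  have hgood := hS.good_cons hv hw hvw hle
  obtain ⟨h1, h2, h3, h4, h5, h6⟩ := hS
  have hlt := h1 v hv
  obtain ⟨n1, n2⟩ := (hl.of_nxt _ hlt (by omega)).resolve_left hN
  have hself : nxt (ptr v) ≠ ptr v := by
    intro h
    have := hl.of_prd _ hlt
    rw [h] at n2
    omega
  have hnot : ∀ q < m, ptr q ≠ nxt (ptr v) := by
    intro q hq h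
    rcases h4 q hq with h' | h' <;> rw [h, n2] at h'
    · omega
    · exact h3 v hv h'
  have hnotL : nxt (ptr v) ∉ L := by
    intro h
    rcases h5 _ h with h' | h' <;> rw [n2] at h'
    · omega
    · exact h3 v hv h'
  refine ⟨?_, ?_, ?_, ?_, ?_, hgood⟩
  · intro q hq
    by_cases hqv : q = v
    · subst hqv; simpa using n1
    · rw [Function.update_of_ne hqv]; exact h1 q hq
  · intro q hq q' hq' heq
    by_cases hqv : q = v <;> by_cases hqv' : q' = v
    · omega
    · subst hqv
      rw [Function.update_self, Function.update_of_ne hqv'] at heq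
      exact absurd heq.symm (hnot q' hq')
    · subst hqv'
      rw [Function.update_self, Function.update_of_ne hqv] at heq
      exact absurd heq (hnot q hq)
    · rw [Function.update_of_ne hqv, Function.update_of_ne hqv'] at heq
      exact h2 q hq q' hq' heq
  · intro q hq
    by_cases hqv : q = v
    · subst hqv; simp [hself, hnotL]
    · rw [Function.update_of_ne hqv]
      simp only [List.mem_cons, not_or]
      exact ⟨fun h => hqv (h2 q hq v hv h), h3 q hq⟩
  · intro q hq
    by_cases hqv : q = v
    · subst hqv; simp [n2]
    · rw [Function.update_of_ne hqv]
      exact (h4 q hq).imp_right (List.mem_cons_of_mem _)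
  · intro z hz
    rcases List.mem_cons.1 hz with rfl | hz
    · exact (h4 v hv).imp_right (List.mem_cons_of_mem _)
    · exact (h5 z hz).imp_right (List.mem_cons_of_mem _)

theorem Listed.search {prd wit : ℕ → ℕ} {X m : ℕ} {bot : ℕ → ℕ} (hL : Listed I.N prd X m bot)
    {ptr : ℕ → ℕ} (hptr : ∀ q < m, ptr q = bot q) : Search I prd wit X m ptr [] := by
  refine ⟨?_, ?_, by simp, ?_, by simp, trivial⟩
  · intro q hq; rw [hptr q hq]; exact hL.lt q hq
  · intro q hq q' hq'; rw [hptr q hq, hptr q' hq']; exact hL.inj q hq q' hq'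
  · intro q hq; rw [hptr q hq]; exact Or.inl (hL.bottom q hq)

/-- Compute the relation of an antichain. -/
def equality : Prog := .ite (teq .i .j) (assign .a 1) (assign .a 0)

theorem sat_equality (h : Store) (Post : Store → Prop)
    (hp : ∀ clk, clk ≤ h.clk + 3 → Post { h with a := if h.i = h.j then 1 else 0, clk := clk }) :
    Sat I equality h Post := by
  refine sat_ite (satTest_teq _ _ _) ?_ ?_
  · intro hij
    replace hij : h.i = h.j := hij
    refine sat_assign le_rfl ?_
    have := hp (h.clk + 2) (by omega)
    rwa [if_pos hij] at this
  · intro hij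
    replace hij : h.i ≠ h.j := hij
    refine sat_assign (by omega) ?_
    have := hp (h.clk + 2) (by omega)
    rwa [if_neg hij] at this

/-- Advance the pointers along their chains until they form an antichain (`f = 0`) or the top `u`
of a chain has to be passed (`f = 1`), recording a witness for each element passed. -/
def seek : Prog :=
  assign .go 1 ⨾ .loop (teq .go .one)
    (scan equality ⨾ .ite (teq .f .one)
      (fetch .u .ptr .v ⨾ fetch .y .ptr .w ⨾ write .wit .u .y ⨾ fetch .t .nxt .u ⨾
        .ite (teq .t .n) (assign .go 0) (write .ptr .v .t))
      (assign .go 0))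

/-- The parts of the state that the chain construction keeps. -/
structure Store.Const (I : Inst) (h : Store) : Prop where
  k : h.k = I.K
  n : h.n = I.N
  one : h.one = 1

/-- Every round but the last adds an element to the list of passed elements, whose length is at most
`X`; hence `X + 1` rounds suffice. -/
theorem sat_seek {h : Store} {Post : Store → Prop} {X : ℕ} (hconst : h.Const I) (hX : X ≤ I.N)
    (hlinks : Links I h.prd h.nxt X I.N) (hlX : h.l ≤ X)
    (hS : Search I h.prd h.wit X h.l h.ptr [])
    (hp : ∀ h' : Store, h'.Const I → h'.x = h.x → h'.prd = h.prd → h'.nxt = h.nxt →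
      h'.clk ≤ h.clk + (X + 2) * (40 * (h.l + 1) ^ 2 + 40) →
      (h'.f = 0 ∧ h.l ≤ I.W ∨
        h'.f = 1 ∧ h.nxt h'.u = I.N ∧ ∃ L, Good I h.prd h'.wit X (h'.u :: L)) → Post h') :
    Sat I seek h Post := by
  refine sat_seq (sat_assign le_rfl ?_)
  refine sat_loop (P := fun h' => h'.go = h'.one)
    (fun r h' => h'.Const I ∧ h'.x = h.x ∧ h'.prd = h.prd ∧ h'.nxt = h.nxt ∧ h'.l = h.l ∧
      ((h'.go = 1 ∧ ∃ L, r + L.length = X + 1 ∧ Search I h.prd h'.wit X h.l h'.ptr L) ∨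
        (h'.go = 0 ∧ (h'.f = 0 ∧ h.l ≤ I.W ∨
          h'.f = 1 ∧ h.nxt h'.u = I.N ∧ ∃ L, Good I h.prd h'.wit X (h'.u :: L)))))
    (40 * (h.l + 1) ^ 2 + 40) (fun h' => satTest_teq _ _ h') (X + 1)
    ⟨⟨hconst.k, hconst.n, hconst.one⟩, rfl, rfl, rfl, rfl, Or.inl ⟨rfl, [], by simp, hS⟩⟩ ?_ ?_
  · clear hS
    rintro r h' ⟨hc, hx, hprd, hnxt, hl, hcase⟩ hgo
    have h1 := hc.one
    rcases hcase with ⟨-, L, hr, hS⟩ | ⟨hgo', -⟩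
    swap
    · omega
    have hlen := hS.good.length_le
    refine sat_seq (sat_scan (R := fun q q' => q = q') h1
      (by dsimp only [Store.tick]; omega) ?_ ?_ ?_)
    · intro q hq
      have := hS.lt q (by rw [← hl]; exact hq)
      exact lt_of_lt_of_le this hX
    · intro h'' _ _ Post' hPost'
      exact sat_equality h'' Post' fun clk hclk => by convert hPost' clk hclk
    · intro f i j a t u c v w clk hclk hf
      dsimp only [Store.tick] at hclk hf ⊢
      rw [hl] at hclk hf
      refine sat_ite (satTest_teq _ _ _) ?_ ?_
      · intro hf1
        replace hf1 : f = 1 := hf1.trans h1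
        obtain ⟨hv, hw, hforce⟩ := (hf.resolve_left (by omega)).2
        -- For the relation of equality, the second kind of mismatch would contradict reflexivity.
        have hforce : v ≠ w ∧ I.le (h'.ptr v) (h'.ptr w) := by
          rcases hforce with h | ⟨rfl, h⟩
          · exact h
          · exact absurd (I.le_refl _ (lt_of_lt_of_le (hS.lt w hw) hX)) h
        refine sat_seq (sat_fetch (sat_seq (sat_fetch (sat_seq (sat_write (sat_seq
          (sat_fetch (sat_ite (satTest_teq _ _ _) ?_ ?_))))))))
        · intro ht
          refine sat_assign (by omega) ?_
          dsimp only [Store.tick, Store.set, Store.setA, Store.get, Store.getA] at ht ⊢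
          refine ⟨0, by omega, ⟨⟨hc.k, hc.n, hc.one⟩, hx, hprd, hnxt, hl, Or.inr ⟨rfl, Or.inr
            ⟨hf1, ?_, L, hS.good_cons hv hw hforce.1 hforce.2⟩⟩⟩, by omega⟩
          rw [← hnxt, ht, hc.n]
        · intro ht
          refine sat_write ?_
          dsimp only [Store.tick, Store.set, Store.setA, Store.get, Store.getA] at ht ⊢
          rw [hnxt, hc.n] at ht
          refine ⟨r - 1, by omega, ⟨⟨hc.k, hc.n, hc.one⟩, hx, hprd, hnxt, hl, Or.inl ⟨?_,
            h'.ptr v :: L, by simp only [List.length_cons]; omega, ?_⟩⟩, by omega⟩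
          · rw [hgo, h1]
          · rw [hnxt]
            exact hS.advance hX hlinks hv hw hforce.1 hforce.2 ht
      · intro hf1
        replace hf1 : f ≠ 1 := fun h => hf1 (h.trans h1.symm)
        refine sat_assign (by omega) ?_
        dsimp only [Store.tick, Store.set, Store.setA, Store.get, Store.getA]
        rcases hf with ⟨hf0, hf⟩ | hf
        · refine ⟨0, by omega, ⟨⟨hc.k, hc.n, hc.one⟩, hx, hprd, hnxt, hl, Or.inr ⟨rfl, Or.inl
            ⟨hf0, ?_⟩⟩⟩, by omega⟩
          -- The pointers form an antichain with one element for each chain.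
          exact I.width h.l h'.ptr (fun q hq => lt_of_lt_of_le (hS.lt q hq) hX)
            fun q hq q' hq' hne hle => hne ((hf q hq q' hq').2 hle)
        · omega
  · rintro r h' ⟨hc, hx, hprd, hnxt, hl, hcase⟩ hgo hclk
    rcases hcase with ⟨hgo', -⟩ | ⟨-, hcase⟩
    · exact absurd (hgo'.trans hc.one.symm) hgo
    refine hp _ ⟨hc.k, hc.n, hc.one⟩ hx hprd hnxt ?_ hcase
    dsimp only [Store.tick, Store.set] at hclk ⊢
    have : (X + 2) * (40 * (h.l + 1) ^ 2 + 40) =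
      (X + 1) * (40 * (h.l + 1) ^ 2 + 40) + (40 * (h.l + 1) ^ 2 + 40) := by ring
    omega

/-! ### Chain decomposition -/

/-- Insert the element `x` into the chain partition of the elements below `x`. -/
def insert : Prog :=
  plus .lim .x .one ⨾ write .prd .x .n ⨾ write .nxt .x .n ⨾ collect ⨾ move .l .m ⨾ reset ⨾
    seek ⨾ .ite (teq .f .one) augment .skip ⨾ plus .x .x .one

/-- Partition the second poset into chains. -/
def decompose : Prog := assign .x 0 ⨾ .loop (tlt .x .n) insert

theorem Listed.le {N : ℕ} {prd : ℕ → ℕ} {X m : ℕ} {bot : ℕ → ℕ} (hL : Listed N prd X m bot) :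
    m ≤ X := by
  rw [hL.card]
  exact (Finset.card_filter_le _ _).trans (Finset.card_range X).le

theorem insert_cost {N W X m : ℕ} (hX : X ≤ N) (hX1 : 1 ≤ X) (hm : m ≤ W + 1) (hmX : m ≤ X) :
    (X + 2) * (40 * (m + 1) ^ 2 + 40) + 56 * X + 20 * m + 60 ≤ 400 * N * (W + 2) ^ 2 := by
  have h1 : (m + 1) ^ 2 ≤ (W + 2) ^ 2 := Nat.pow_le_pow_left (by omega) 2
  have h2 : 4 ≤ (W + 2) ^ 2 := by nlinarith
  generalize (m + 1) ^ 2 = z at *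
  generalize (W + 2) ^ 2 = Z at *
  -- Here X + 2 ≤ 3X ≤ 3N because 1 ≤ X ≤ N.
  have h3 : (X + 2) * (40 * z + 40) ≤ (3 * N) * (40 * Z + 40) :=
    Nat.mul_le_mul (by omega) (by omega)
  have h4 : N * 4 ≤ N * Z := Nat.mul_le_mul_left N h2
  have h5 : 3 * N * (40 * Z + 40) = 120 * (N * Z) + 120 * N := by ring
  have h6 : 400 * N * Z = 400 * (N * Z) := by ring
  omega

/-- The new singleton raises the number of chains to at most W + 1. Either an antichain shows that
the number is at most W, or one chain is removed. -/
theorem sat_insert {h : Store} {Post : Store → Prop} (hconst : h.Const I) (hx : h.x < I.N)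
    (hlinks : Links I h.prd h.nxt h.x I.N) (hcard : (bottoms I.N h.prd h.x).card ≤ I.W)
    (hp : ∀ h' : Store, h'.Const I → h'.x = h.x + 1 → Links I h'.prd h'.nxt (h.x + 1) I.N →
      (bottoms I.N h'.prd (h.x + 1)).card ≤ I.W →
      h'.clk ≤ h.clk + 400 * I.N * (I.W + 2) ^ 2 → Post h') :
    Sat I insert h Post := by
  obtain ⟨hk, hn, h1⟩ := hconst
  refine sat_seq (sat_plus ?_ (sat_seq (sat_write (sat_seq (sat_write (sat_seq ?_))))))
  · simp only [Store.get, Inst.bd]; omega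
  dsimp only [Store.tick, Store.set, Store.setA, Store.get, Store.getA]
  rw [h1, hn]
  have hlinks' := hlinks.insert
  have hcard' := card_bottoms_insert (N := I.N) (prd := h.prd) (X := h.x)
  refine sat_collect rfl rfl (by dsimp only; omega) ?_
  intro m i t bot dig clk hL hdig hclk
  dsimp only at hL hclk ⊢
  have hm : m ≤ I.W + 1 := by rw [hL.card, hcard']; omega
  have hmX := hL.le
  refine sat_seq (sat_move (sat_seq (sat_reset rfl ?_ ?_)))
  · dsimp only [Store.tick, Store.set, Store.setA, Store.get, Store.getA]; omega
  intro i t ptr clk' hptr hclk'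
  dsimp only [Store.tick, Store.set, Store.setA, Store.get, Store.getA] at hptr hclk' ⊢
  refine sat_seq (sat_seek (X := h.x + 1) ⟨hk, rfl, rfl⟩ hx hlinks' hmX
    (hL.search fun q hq => ?_) ?_)
  · dsimp only; rw [hptr q hq, hdig q hq]
  intro h' hc' hx' hprd' hnxt' hclk'' hcase
  dsimp only at hx' hprd' hnxt' hclk'' hcase
  have hcost := insert_cost (N := I.N) (W := I.W) (X := h.x + 1) (m := m) hx (by omega) hm hmX
  refine sat_seq (sat_ite (satTest_teq _ _ _) ?_ ?_)
  · intro hf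
    replace hf : h'.f = 1 := hf.trans hc'.one
    obtain ⟨-, hnu, L, hG⟩ := hcase.resolve_left (by omega)
    refine sat_augment (X := h.x + 1) (L := L) hc'.n hx ?_ ?_ ?_
    · dsimp only [Store.tick]; rw [hprd']; exact hG
    · dsimp only [Store.tick]; rw [hprd', hnxt']; exact hlinks'.dangling hx hnu
    intro y t u prd nxt clk3 hl3 hcard3 hclk3
    dsimp only [Store.tick] at hclk3 hcard3 ⊢
    rw [hprd', hcard'] at hcard3
    refine sat_plus ?_ ?_
    · simp only [Store.get, Inst.bd, hc'.one, hx']; omega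
    dsimp only [Store.tick, Store.set, Store.setA, Store.get, Store.getA]
    refine hp _ ⟨hc'.k, hc'.n, hc'.one⟩ (by dsimp only; rw [hx', hc'.one]) hl3 ?_ ?_
    · dsimp only; omega
    · dsimp only; omega
  · intro hf
    replace hf : h'.f ≠ 1 := fun h => hf (h.trans hc'.one.symm)
    have hW := (hcase.resolve_right (fun h => hf h.1)).2
    refine sat_skip (sat_plus ?_ ?_)
    · simp only [Store.tick, Store.get, Inst.bd, hc'.one, hx']; omega
    dsimp only [Store.tick, Store.set, Store.setA, Store.get, Store.getA]
    refine hp _ ⟨hc'.k, hc'.n, hc'.one⟩ (by dsimp only; rw [hx', hc'.one]) ?_ ?_ ?_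
    · dsimp only; rw [hprd', hnxt']; exact hlinks'
    · dsimp only; rw [hprd', ← hL.card]; exact hW
    · dsimp only; omega

theorem sat_decompose {h : Store} {Post : Store → Prop} (hconst : h.Const I)
    (hp : ∀ h' : Store, h'.Const I → Links I h'.prd h'.nxt I.N I.N →
      (bottoms I.N h'.prd I.N).card ≤ I.W →
      h'.clk ≤ h.clk + I.N * (400 * I.N * (I.W + 2) ^ 2 + 1) + 2 → Post h') :
    Sat I decompose h Post := by
  refine sat_seq (sat_assign (by omega) ?_)
  refine sat_loop (P := fun h' => h'.x < h'.n)
    (fun r h' => h'.Const I ∧ r + h'.x = I.N ∧ Links I h'.prd h'.nxt h'.x I.N ∧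
      (bottoms I.N h'.prd h'.x).card ≤ I.W) (400 * I.N * (I.W + 2) ^ 2 + 1)
    (fun h' => satTest_tlt _ _ h') I.N
    ⟨⟨hconst.k, hconst.n, hconst.one⟩, rfl, ⟨by simp [Store.tick, Store.set],
      by simp [Store.tick, Store.set]⟩, (Nat.zero_le _).trans' (listed_zero I.N h.prd h.bot).card.ge⟩ ?_ ?_
  · rintro r h' ⟨hc, hr, hl, hcard⟩ hlt
    rw [hc.n] at hlt
    refine sat_insert ⟨hc.k, hc.n, hc.one⟩ hlt hl hcard ?_
    intro h'' hc'' hx'' hl'' hcard'' hclk''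
    dsimp only [Store.tick] at hx'' hl'' hcard'' hclk''
    refine ⟨r - 1, by omega, ⟨hc'', by omega, ?_, ?_⟩, by omega⟩
    · rwa [hx'']
    · rwa [hx'']
  · rintro r h' ⟨hc, hr, hl, hcard⟩ hlt hclk
    rw [hc.n] at hlt
    have hxN : h'.x = I.N := by omega
    rw [hxN] at hl hcard
    refine hp _ ⟨hc.k, hc.n, hc.one⟩ hl hcard ?_
    dsimp only [Store.tick, Store.set] at hclk ⊢
    omega

/-! ### Forced advances for a fixed assignment of chains -/

/-- `s` embeds the first poset into the second one. -/
def Solution (I : Inst) (s : ℕ → ℕ) : Prop :=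
  (∀ q < I.K, s q < I.N) ∧ ∀ q < I.K, ∀ q' < I.K, I.qle q q' ↔ I.le (s q) (s q')

/-- `z'` is reached from `z` by following successor links. -/
def Reach (I : Inst) (nxt : ℕ → ℕ) : ℕ → ℕ → Prop :=
  Relation.ReflTransGen fun z z' => nxt z = z' ∧ z' < I.N

theorem Links.le_nxt {prd nxt : ℕ → ℕ} (hL : Links I prd nxt I.N I.N) {z : ℕ} (hz : z < I.N)
    (hn : nxt z < I.N) : I.le z (nxt z) ∧ z ≠ nxt z := by
  have h1 := (hL.of_nxt z hz (by omega)).resolve_left (by omega)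
  have h2 := hL.of_prd _ hn
  rw [h1.2] at h2
  exact (h2.resolve_left (by omega)).2.2.2

theorem Reach.le {prd nxt : ℕ → ℕ} (hL : Links I prd nxt I.N I.N) {z z' : ℕ}
    (h : Reach I nxt z z') (hz : z < I.N) : I.le z z' := by
  suffices z' < I.N ∧ I.le z z' from this.2
  induction h with
  | refl => exact ⟨hz, I.le_refl z hz⟩
  | tail _ h ih =>
    obtain ⟨rfl, hlt⟩ := h
    exact ⟨hlt, I.le_trans _ _ _ ih.2 (hL.le_nxt ih.1 hlt).1⟩

theorem Reach.nxt_of_ne {nxt : ℕ → ℕ} {z z' : ℕ} (h : Reach I nxt z z') (hne : z ≠ z') :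
    nxt z < I.N ∧ Reach I nxt (nxt z) z' := by
  rcases Relation.ReflTransGen.cases_head h with h | ⟨y, ⟨rfl, hy⟩, h⟩
  · exact absurd h hne
  · exact ⟨hy, h⟩

open Classical in
/-- Number of elements above `z`. -/
noncomputable def height (I : Inst) (z : ℕ) : ℕ := {y ∈ Finset.range I.N | I.le z y}.card

open Classical in
/-- Number of elements below `z`. -/
noncomputable def depth (I : Inst) (z : ℕ) : ℕ := {y ∈ Finset.range I.N | I.le y z}.card

theorem height_le (I : Inst) (z : ℕ) : height I z ≤ I.N := by
  classical
  simpa [height] using Finset.card_filter_le (Finset.range I.N) fun y => I.le z y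

theorem height_lt {z z' : ℕ} (hz : z < I.N) (hle : I.le z z') (hne : z ≠ z') :
    height I z' < height I z := by
  refine Finset.card_lt_card ((Finset.ssubset_iff_of_subset ?_).2 ⟨z, ?_, ?_⟩)
  · intro y hy
    simp only [Finset.mem_filter] at hy ⊢
    exact ⟨hy.1, I.le_trans _ _ _ hle hy.2⟩
  · simpa using ⟨hz, I.le_refl z hz⟩
  · simp only [Finset.mem_filter, not_and]
    exact fun _ h => hne (I.le_antisymm _ _ hle h)

theorem depth_lt {z z' : ℕ} (hz : z' < I.N) (hle : I.le z z') (hne : z ≠ z') :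
    depth I z < depth I z' := by
  refine Finset.card_lt_card ((Finset.ssubset_iff_of_subset ?_).2 ⟨z', ?_, ?_⟩)
  · intro y hy
    simp only [Finset.mem_filter] at hy ⊢
    exact ⟨hy.1, I.le_trans _ _ _ hy.2 hle⟩
  · simpa using ⟨hz, I.le_refl z' hz⟩
  · simp only [Finset.mem_filter, not_and]
    exact fun _ h => hne (I.le_antisymm _ _ hle h)

/-- Following predecessor links strictly lowers the depth, so the descent ends at a listed bottom.
-/
theorem Listed.exists_reach {prd nxt bot : ℕ → ℕ} {m : ℕ} (hL : Links I prd nxt I.N I.N)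
    (hB : Listed I.N prd I.N m bot) (z : ℕ) (hz : z < I.N) : ∃ q < m, Reach I nxt (bot q) z := by
  induction hd : depth I z using Nat.strong_induction_on generalizing z with
  | _ d ih =>
    subst hd
    rcases hL.of_prd z hz with h | ⟨h1, -, h3, h4, h5⟩
    · obtain ⟨q, hq, rfl⟩ := hB.surj z hz h
      exact ⟨q, hq, .refl⟩
    · obtain ⟨q, hq, hr⟩ := ih _ (depth_lt hz h4 h5) _ h1 rfl
      exact ⟨q, hq, hr.tail ⟨h3, hz⟩⟩

/-- Suppose s v = ptr v. The first kind of mismatch gives s v ≤ ptr w ≤ s w although v ≤ w fails in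
Q; the second gives ptr w ≤ s w ≤ s v = ptr v, which was denied. So s v lies strictly higher on its
chain. -/
theorem Forced.reach {prd nxt ptr s : ℕ → ℕ} (hL : Links I prd nxt I.N I.N)
    (hptr : ∀ q < I.K, ptr q < I.N) (hs : Solution I s)
    (hreach : ∀ q < I.K, Reach I nxt (ptr q) (s q)) {v w : ℕ}
    (hF : Forced I I.qle I.K ptr v w) :
    nxt (ptr v) < I.N ∧ Reach I nxt (nxt (ptr v)) (s v) := by
  obtain ⟨hv, hw, hF⟩ := hF
  refine (hreach v hv).nxt_of_ne fun heq => ?_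
  have hwle := (hreach w hw).le hL (hptr w hw)
  rcases hF with ⟨h1, h2⟩ | ⟨h1, h2⟩
  · exact h1 ((hs.2 v hv w hw).2 (heq ▸ I.le_trans _ _ _ h2 hwle))
  · exact h2 (heq ▸ I.le_trans _ _ _ hwle ((hs.2 w hw v hv).1 h1))

/-- Advance the pointers along their chains until they form an embedding (`f = 0`) or the top of a
chain has to be passed (`f = 1`). -/
def propagate : Prog :=
  assign .g 1 ⨾ .loop (teq .g .one)
    (scan (fetchQ .a .i .j) ⨾ .ite (teq .f .one)
      (fetch .u .ptr .v ⨾ fetch .t .nxt .u ⨾ .ite (teq .t .n) (assign .g 0) (write .ptr .v .t))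
      (assign .g 0))

/-- The total height of the pointers is the potential: it starts at no more than K·N and drops with
every advance. -/
theorem sum_height_lt {K : ℕ} {ptr : ℕ → ℕ} {v z : ℕ} (hv : v < K)
    (h : height I z < height I (ptr v)) :
    ∑ q ∈ Finset.range K, height I (Function.update ptr v z q) <
      ∑ q ∈ Finset.range K, height I (ptr q) := by
  refine Finset.sum_lt_sum (fun q _ => ?_) ⟨v, by simpa using hv, by simpa using h⟩
  by_cases hq : q = v
  · subst hq; simpa using h.le
  · rw [Function.update_of_ne hq]

/-- All advances are forced, so solutions above the initial pointers remain above the current ones.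
A forced advance past a top therefore refutes the whole assignment. -/
theorem sat_propagate {h : Store} {Post : Store → Prop} (hconst : h.Const I) (hl : h.l = I.K)
    (hlinks : Links I h.prd h.nxt I.N I.N) (hptr : ∀ q < I.K, h.ptr q < I.N)
    (hp : ∀ f g i j a t u c v w ptr clk,
      clk ≤ h.clk + (I.K * I.N + 1) * (40 * (I.K + 1) ^ 2 + 30) + 2 →
      (f = 0 ∧ Solution I ptr ∨
        f = 1 ∧ ∀ s, Solution I s → ¬ ∀ q < I.K, Reach I h.nxt (h.ptr q) (s q)) →
      Post { h with f := f, g := g, i := i, j := j, a := a, t := t, u := u, c := c, v := v,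
                    w := w, ptr := ptr, clk := clk }) :
    Sat I propagate h Post := by
  obtain ⟨hk, hn, h1⟩ := hconst
  refine sat_seq (sat_assign le_rfl ?_)
  refine sat_loop (P := fun h' => h'.g = h'.one)
    (fun r h' => ∃ f g i j a t u c v w ptr clk,
      h' = { h with f := f, g := g, i := i, j := j, a := a, t := t, u := u, c := c, v := v,
                    w := w, ptr := ptr, clk := clk } ∧
      ((g = 1 ∧ (∀ q < I.K, ptr q < I.N) ∧ ∑ q ∈ Finset.range I.K, height I (ptr q) < r ∧
        ∀ s, Solution I s → (∀ q < I.K, Reach I h.nxt (h.ptr q) (s q)) →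
          ∀ q < I.K, Reach I h.nxt (ptr q) (s q)) ∨
        (g = 0 ∧ (f = 0 ∧ Solution I ptr ∨
          f = 1 ∧ ∀ s, Solution I s → ¬ ∀ q < I.K, Reach I h.nxt (h.ptr q) (s q)))))
    (40 * (I.K + 1) ^ 2 + 30) (fun h' => satTest_teq _ _ h') (I.K * I.N + 1)
    ⟨h.f, 1, h.i, h.j, h.a, h.t, h.u, h.c, h.v, h.w, h.ptr, h.clk + 1, rfl,
      Or.inl ⟨rfl, hptr, ?_, fun s _ hs => hs⟩⟩ ?_ ?_
  · have := Finset.sum_le_card_nsmul (Finset.range I.K) (fun q => height I (h.ptr q)) I.N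
      fun q _ => height_le I _
    simp only [Finset.card_range, smul_eq_mul] at this
    omega
  · rintro r _ ⟨f, g, i, j, a, t, u, c, v, w, ptr, clk, rfl, hcase⟩ hg
    dsimp only at hg
    rcases hcase with ⟨-, hptr', hr, hinv⟩ | ⟨hg', -⟩
    swap
    · omega
    refine sat_seq (sat_scan (R := I.qle) h1 ?_ ?_ ?_ ?_)
    · dsimp only [Store.tick]; omega
    · dsimp only [Store.tick]; rw [hl]; exact hptr'
    · intro h'' hi hj Post' hPost'
      dsimp only [Store.tick] at hi hj
      rw [hl] at hi hj
      exact sat_fetchQ hi hj (hPost' _ le_rfl)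
    intro f i j a t u c v w clk' hclk hf
    dsimp only [Store.tick] at hclk hf ⊢
    rw [hl] at hclk hf
    refine sat_ite (satTest_teq _ _ _) ?_ ?_
    · intro hf1
      replace hf1 : f = 1 := hf1.trans h1
      have hF := (hf.resolve_left (by omega)).2
      refine sat_seq (sat_fetch (sat_seq (sat_fetch (sat_ite (satTest_teq _ _ _) ?_ ?_))))
      · intro ht
        refine sat_assign (by omega) ?_
        dsimp only [Store.tick, Store.set, Store.setA, Store.get, Store.getA] at ht ⊢
        refine ⟨0, by omega, ⟨_, _, _, _, _, _, _, _, _, _, _, _, rfl, Or.inr ⟨rfl, Or.inr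
          ⟨hf1, fun s hs hreach => ?_⟩⟩⟩, by omega⟩
        have := (hF.reach hlinks hptr' hs (hinv s hs hreach)).1
        omega
      · intro ht
        refine sat_write ?_
        dsimp only [Store.tick, Store.set, Store.setA, Store.get, Store.getA] at ht ⊢
        have hv := hF.1
        have hvN := hptr' v hv
        have hlt : h.nxt (ptr v) < I.N :=
          ((hlinks.of_nxt _ hvN (by omega)).resolve_left (by omega)).1
        have hle := hlinks.le_nxt hvN hlt
        refine ⟨r - 1, by omega, ⟨_, _, _, _, _, _, _, _, _, _, _, _, rfl, Or.inl ⟨by omega,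
          ?_, ?_, ?_⟩⟩, by omega⟩
        · intro q hq
          by_cases hqv : q = v
          · subst hqv; simpa using hlt
          · rw [Function.update_of_ne hqv]; exact hptr' q hq
        · have := sum_height_lt (ptr := ptr) hv (height_lt hvN hle.1 hle.2)
          omega
        · intro s hs hreach q hq
          by_cases hqv : q = v
          · subst hqv
            simpa using (hF.reach hlinks hptr' hs (hinv s hs hreach)).2
          · rw [Function.update_of_ne hqv]; exact hinv s hs hreach q hq
    · intro hf1
      replace hf1 : f ≠ 1 := fun h => hf1 (h.trans h1.symm)
      refine sat_assign (by omega) ?_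
      dsimp only [Store.tick, Store.set, Store.setA, Store.get, Store.getA]
      rcases hf with ⟨hf0, hf⟩ | hf
      · exact ⟨0, by omega, ⟨_, _, _, _, _, _, _, _, _, _, _, _, rfl, Or.inr ⟨rfl, Or.inl
          ⟨hf0, hptr', hf⟩⟩⟩, by omega⟩
      · omega
  · rintro r _ ⟨f, g, i, j, a, t, u, c, v, w, ptr, clk, rfl, hcase⟩ hg hclk
    dsimp only [Store.tick, Store.set] at hg hclk ⊢
    rcases hcase with ⟨hg', -⟩ | ⟨-, hcase⟩
    · omega
    · exact hp _ _ _ _ _ _ _ _ _ _ _ _ (by omega) hcase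

/-! ### Enumeration of the assignments of chains -/

/-- The digits of `M` in base `m` are the first `K` entries of the array. -/
def Digits (K m M : ℕ) (dig : ℕ → ℕ) : Prop := ∀ q < K, dig q = M / m ^ q % m

/-- Guarantees that counting up to `m ^ K` meets every assignment; the number is built by Horner's
rule. -/
theorem exists_digits {m : ℕ} (hm : 0 < m) (K : ℕ) (f : ℕ → ℕ) (hf : ∀ q < K, f q < m) :
    ∃ M < m ^ K, Digits K m M f := by
  induction K generalizing f with
  | zero => exact ⟨0, by simp, by simp [Digits]⟩
  | succ K ih =>
    obtain ⟨M, hM, hd⟩ := ih (fun q => f (q + 1)) fun q hq => hf (q + 1) (by omega)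
    have h0 := hf 0 (by omega)
    refine ⟨f 0 + m * M, ?_, ?_⟩
    · rw [pow_succ']
      nlinarith
    · rintro (_ | q) hq
      · simp [Nat.mod_eq_of_lt h0]
      · rw [show f (q + 1) = M / m ^ q % m from hd q (by omega), pow_succ', ← Nat.div_div_eq_div_mul, Nat.add_mul_div_left _ _ hm,
          Nat.div_eq_of_lt h0, Nat.zero_add]

/-- Increment the number represented by the digits; stop the enumeration on overflow. -/
def increment : Prog :=
  assign .c 1 ⨾ assign .i 0 ⨾
    .loop (tlt .i .k)
      (.ite (teq .c .one)
        (fetch .t .dig .i ⨾ plus .t .t .one ⨾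
          .ite (tlt .t .m) (write .dig .i .t ⨾ assign .c 0) (assign .t 0 ⨾ write .dig .i .t))
        .skip ⨾
      plus .i .i .one) ⨾
    .ite (teq .c .one) (assign .go 0) .skip

/-- The carry into place i is 1 exactly when m^i divides M + 1, and then digit i grows by one modulo
m. A carry out of the last place means that the enumeration has wrapped around. -/
theorem sat_increment {h : Store} {Post : Store → Prop} {M : ℕ} (hconst : h.Const I)
    (hm : 0 < h.m) (hmN : h.m ≤ I.N) (hd : Digits I.K h.m M h.dig)
    (hp : ∀ c i t dig go clk, Digits I.K h.m (M + 1) dig →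
      (h.m ^ I.K ∣ M + 1 → go = 0) → (¬ h.m ^ I.K ∣ M + 1 → go = h.go) →
      clk ≤ h.clk + 30 * I.K + 6 →
      Post { h with c := c, i := i, t := t, dig := dig, go := go, clk := clk }) :
    Sat I increment h Post := by
  obtain ⟨hk, hn, h1⟩ := hconst
  refine sat_seq (sat_assign le_rfl (sat_seq (sat_assign (by omega) (sat_seq ?_))))
  refine sat_loop (P := fun h' => h'.i < h'.k)
    (fun r h' => ∃ c i t dig clk,
      h' = { h with c := c, i := i, t := t, dig := dig, clk := clk } ∧ r + i = I.K ∧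
      (∀ q < i, dig q = (M + 1) / h.m ^ q % h.m) ∧
      (∀ q < I.K, i ≤ q → dig q = M / h.m ^ q % h.m) ∧
      c = if h.m ^ i ∣ M + 1 then 1 else 0) 30
    (fun h' => satTest_tlt _ _ h') I.K
    ⟨1, 0, h.t, h.dig, _, rfl, by omega, by simp, fun q hq _ => hd q hq, by simp⟩ ?_ ?_
  · rintro r _ ⟨c, i, t, dig, clk, rfl, hr, hlow, hhigh, hc⟩ hlt
    dsimp only at hlt
    rw [hk] at hlt
    have hdig := hhigh i hlt le_rfl
    have hdlt : dig i < h.m := by rw [hdig]; exact Nat.mod_lt _ hm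
    have hsucc := Nat.succ_div (a := M) (b := h.m ^ i)
    -- The carry survives place i exactly when the new digit there is 0.
    have hdvd : h.m ^ (i + 1) ∣ M + 1 ↔
        h.m ^ i ∣ M + 1 ∧ h.m ∣ (M + 1) / h.m ^ i := by
      constructor
      · intro hdiv
        have h' : h.m ^ i ∣ M + 1 := (pow_dvd_pow _ (by omega)).trans hdiv
        exact ⟨h', (Nat.dvd_div_iff_mul_dvd h').2 (by rwa [← pow_succ])⟩
      · rintro ⟨h', h''⟩
        rw [pow_succ]
        exact (Nat.dvd_div_iff_mul_dvd h').1 h''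
    refine sat_seq (sat_ite (satTest_teq _ _ _) ?_ ?_)
    · intro hc1
      replace hc1 : c = 1 := hc1.trans h1
      have hdiv : h.m ^ i ∣ M + 1 := by
        by_contra hdiv
        rw [if_neg hdiv] at hc
        omega
      rw [if_pos hdiv] at hsucc
      have hnew : (M + 1) / h.m ^ i % h.m = (dig i + 1) % h.m := by
        rw [hsucc, hdig, Nat.mod_add_mod]
      refine sat_seq (sat_fetch (sat_seq (sat_plus ?_ (sat_ite (satTest_tlt _ _ _) ?_ ?_))))
      · simp only [Store.tick, Store.set, Store.get, Store.getA, Inst.bd]; omega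
      · intro hltm
        dsimp only [Store.tick, Store.set, Store.setA, Store.get, Store.getA] at hltm ⊢
        rw [h1] at hltm ⊢
        refine sat_seq (sat_write (sat_assign (by omega) (sat_plus ?_ ?_)))
        · simp only [Store.tick, Store.set, Store.setA, Store.get, Inst.bd]; omega
        dsimp only [Store.tick, Store.set, Store.setA, Store.get, Store.getA]
        rw [Nat.mod_eq_of_lt hltm] at hnew
        refine ⟨r - 1, by omega, ⟨_, _, _, _, _, rfl, by omega, ?_, ?_, ?_⟩, by omega⟩
        · intro q hq
          by_cases hqi : q = i
          · subst hqi; rw [Function.update_self, hnew]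
          · rw [Function.update_of_ne hqi]; exact hlow q (by omega)
        · intro q hq hiq
          rw [Function.update_of_ne (by omega)]; exact hhigh q hq (by omega)
        · rw [if_neg]
          rw [hdvd, Nat.dvd_iff_mod_eq_zero (n := (M + 1) / h.m ^ i), hnew]
          omega
      · intro hltm
        dsimp only [Store.tick, Store.set, Store.setA, Store.get, Store.getA] at hltm ⊢
        rw [h1] at hltm ⊢
        refine sat_seq (sat_assign (by omega) (sat_write (sat_plus ?_ ?_)))
        · simp only [Store.tick, Store.set, Store.setA, Store.get, Inst.bd]; omega
        dsimp only [Store.tick, Store.set, Store.setA, Store.get, Store.getA]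
        have hm' : dig i + 1 = h.m := by omega
        rw [hm', Nat.mod_self] at hnew
        refine ⟨r - 1, by omega, ⟨_, _, _, _, _, rfl, by omega, ?_, ?_, ?_⟩, by omega⟩
        · intro q hq
          by_cases hqi : q = i
          · subst hqi; rw [Function.update_self, hnew]
          · rw [Function.update_of_ne hqi]; exact hlow q (by omega)
        · intro q hq hiq
          rw [Function.update_of_ne (by omega)]; exact hhigh q hq (by omega)
        · rw [if_pos]
          · exact hc1
          · exact hdvd.2 ⟨hdiv, Nat.dvd_of_mod_eq_zero hnew⟩
    · intro hc1
      replace hc1 : c ≠ 1 := fun h => hc1 (h.trans h1.symm)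
      have hdiv : ¬ h.m ^ i ∣ M + 1 := by
        intro hdiv
        rw [if_pos hdiv] at hc
        exact hc1 hc
      rw [if_neg hdiv] at hsucc hc
      refine sat_skip (sat_plus ?_ ?_)
      · simp only [Store.tick, Store.set, Store.setA, Store.get, Inst.bd]; omega
      dsimp only [Store.tick, Store.set, Store.setA, Store.get, Store.getA]
      refine ⟨r - 1, by omega, ⟨_, _, _, _, _, by rw [h1], by omega, ?_, ?_, ?_⟩, by omega⟩
      · intro q hq
        by_cases hqi : q = i
        · subst hqi; rw [hdig, hsucc, Nat.add_zero]
        · exact hlow q (by omega)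
      · exact fun q hq hiq => hhigh q hq (by omega)
      · rw [if_neg fun h => hdiv (hdvd.1 h).1]; exact hc
  · rintro r _ ⟨c, i, t, dig, clk, rfl, hr, hlow, hhigh, hc⟩ hlt hclk
    dsimp only [Store.tick, Store.set] at hlt hclk ⊢
    rw [hk] at hlt
    have hi : i = I.K := by omega
    subst hi
    refine sat_ite (satTest_teq _ _ _) ?_ ?_
    · intro hc1
      replace hc1 : c = 1 := hc1.trans h1
      have hdiv : h.m ^ I.K ∣ M + 1 := by
        by_contra hdiv
        rw [if_neg hdiv] at hc
        omega
      refine sat_assign (by omega) ?_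
      exact hp _ _ _ _ _ _ hlow (fun _ => rfl) (fun h => absurd hdiv h)
        (by dsimp only [Store.tick, Store.set]; omega)
    · intro hc1
      replace hc1 : c ≠ 1 := fun h => hc1 (h.trans h1.symm)
      have hdiv : ¬ h.m ^ I.K ∣ M + 1 := by
        intro hdiv
        rw [if_pos hdiv] at hc
        exact hc1 hc
      refine sat_skip ?_
      exact hp _ _ _ _ _ _ hlow (fun h => absurd h hdiv) (fun _ => rfl)
        (by dsimp only [Store.tick]; omega)

/-- Set all digits to zero. -/
def clear : Prog :=
  assign .t 0 ⨾ assign .i 0 ⨾ .loop (tlt .i .k) (write .dig .i .t ⨾ plus .i .i .one)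

theorem sat_clear {h : Store} {Post : Store → Prop} (hconst : h.Const I)
    (hp : ∀ i t dig clk, (∀ q < I.K, dig q = 0) → clk ≤ h.clk + 8 * I.K + 3 →
      Post { h with i := i, t := t, dig := dig, clk := clk }) : Sat I clear h Post := by
  obtain ⟨hk, hn, h1⟩ := hconst
  refine sat_seq (sat_assign (by omega) (sat_seq (sat_assign (by omega) ?_)))
  refine sat_loop (P := fun h' => h'.i < h'.k)
    (fun r h' => ∃ i dig clk, h' = { h with i := i, t := 0, dig := dig, clk := clk } ∧
      r + i = I.K ∧ ∀ q < i, dig q = 0) 8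
    (fun h' => satTest_tlt _ _ h') I.K ⟨0, h.dig, _, rfl, by omega, by simp⟩ ?_ ?_
  · rintro r _ ⟨i, dig, clk, rfl, hr, hd⟩ hlt
    dsimp only at hlt
    refine sat_seq (sat_write (sat_plus ?_ ?_))
    · simp only [Store.tick, Store.set, Store.setA, Store.get, Inst.bd]; omega
    · dsimp only [Store.tick, Store.set, Store.setA, Store.get, Store.getA]
      refine ⟨r - 1, by omega, ⟨_, _, _, by rw [h1], by omega, ?_⟩, by omega⟩
      intro q hq
      by_cases hqi : q = i
      · subst hqi; simp
      · rw [Function.update_of_ne hqi]; exact hd q (by omega)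
  · rintro r _ ⟨i, dig, clk, rfl, hr, hd⟩ hlt hclk
    dsimp only [Store.tick, Store.set] at hlt hclk ⊢
    exact hp _ _ _ _ (fun q hq => hd q (by omega)) (by omega)

/-- Try all assignments of chains to the elements of the first poset. -/
def enumerate : Prog :=
  move .lim .n ⨾ collect ⨾ move .l .k ⨾ clear ⨾ assign .res 0 ⨾ assign .go 1 ⨾
    .loop (teq .go .one)
      (reset ⨾ propagate ⨾
        .ite (teq .f .one) increment (assign .res 1 ⨾ assign .go 0))

theorem round_cost {K N : ℕ} (hK : 1 ≤ K) (hN : 1 ≤ N) :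
    (K * N + 1) * (40 * (K + 1) ^ 2 + 30) + 60 * K + 20 ≤ 500 * (K ^ 3 * N) := by
  have h1 : (K + 1) ^ 2 ≤ 4 * K ^ 2 := by nlinarith
  have hKN : 1 ≤ K * N := Nat.mul_pos hK hN
  have hK2 : 1 ≤ K ^ 2 := Nat.pow_pos hK
  have h2 : (K * N + 1) * (40 * (K + 1) ^ 2 + 30) ≤ (2 * (K * N)) * (190 * K ^ 2) :=
    Nat.mul_le_mul (by omega) (by omega)
  have h3 : (2 * (K * N)) * (190 * K ^ 2) = 380 * (K ^ 3 * N) := by ring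
  have h4 : K ≤ K ^ 3 * N := by
    calc K = K * 1 * 1 := by ring
      _ ≤ K * K ^ 2 * N := Nat.mul_le_mul (Nat.mul_le_mul_left _ hK2) hN
      _ = K ^ 3 * N := by ring
  omega

theorem sat_enumerate {h : Store} {Post : Store → Prop} (hconst : h.Const I) (hK : 1 ≤ I.K)
    (hN : 1 ≤ I.N) (hlinks : Links I h.prd h.nxt I.N I.N)
    (hcard : (bottoms I.N h.prd I.N).card ≤ I.W)
    (hp : ∀ h' : Store, (h'.res = 1 ∧ (∃ s, Solution I s) ∨ h'.res = 0 ∧ ¬ ∃ s, Solution I s) →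
      h'.clk ≤ h.clk + I.W ^ I.K * (500 * (I.K ^ 3 * I.N)) + 30 * I.N + 8 * I.K + 20 → Post h') :
    Sat I enumerate h Post := by
  obtain ⟨hk, hn, h1⟩ := hconst
  refine sat_seq (sat_move (sat_seq (sat_collect hn h1 ?_ ?_)))
  · dsimp only [Store.tick, Store.set, Store.get]; omega
  intro m i t bot dig clk hL _ hclk
  dsimp only [Store.tick, Store.set, Store.get] at hL hclk ⊢
  rw [hn] at hL hclk
  have hmW : m ≤ I.W := hL.card ▸ hcard
  have hmN : m ≤ I.N := hL.le
  -- Element 0 exists and lies on a listed chain; a positive base makes every digit a valid chain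
  -- index.
  have hm : 0 < m := by
    obtain ⟨q, hq, -⟩ := hL.exists_reach hlinks 0 hN
    omega
  refine sat_seq (sat_move (sat_seq (sat_clear ⟨hk, hn, h1⟩ ?_)))
  intro i t dig clk' hdig hclk'
  dsimp only [Store.tick, Store.set, Store.get] at hclk' ⊢
  refine sat_seq (sat_assign (by omega) (sat_seq (sat_assign le_rfl ?_)))
  -- While the search runs, the digits show M, and every assignment with a smaller number has been
  -- refuted.
  refine sat_loop (P := fun h' => h'.go = h'.one)
    (fun r h' => h'.Const I ∧ h'.prd = h.prd ∧ h'.nxt = h.nxt ∧ h'.bot = bot ∧ h'.m = m ∧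
      h'.l = I.K ∧
      ((h'.go = 1 ∧ h'.res = 0 ∧ ∃ M, r + M = m ^ I.K ∧ M < m ^ I.K ∧ Digits I.K m M h'.dig ∧
        ∀ M' < M, ∀ s, Solution I s →
          ¬ ∀ q < I.K, Reach I h.nxt (bot (M' / m ^ q % m)) (s q)) ∨
      (h'.go = 0 ∧ (h'.res = 1 ∧ (∃ s, Solution I s) ∨ h'.res = 0 ∧
        ∀ M' < m ^ I.K, ∀ s, Solution I s →
          ¬ ∀ q < I.K, Reach I h.nxt (bot (M' / m ^ q % m)) (s q)))))
    (500 * (I.K ^ 3 * I.N)) (fun h' => satTest_teq _ _ h') (m ^ I.K)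
    ⟨⟨hk, hn, h1⟩, rfl, rfl, rfl, rfl, hk, Or.inl ⟨rfl, rfl, 0, by omega, Nat.pow_pos hm,
      fun q hq => (hdig q hq).trans (by simp), by simp⟩⟩ ?_ ?_
  · rintro r h' ⟨⟨ck, cn, c1⟩, hprd, hnxt, hbot, hm', hl, hcase⟩ hgo
    rcases hcase with ⟨-, hres, M, hr, hM, hD, hno⟩ | ⟨hgo', -⟩
    swap
    · omega
    have hcost := round_cost hK hN
    refine sat_seq (sat_reset c1 ?_ ?_)
    · dsimp only [Store.tick]; omega
    intro i t ptr clk1 hptr hclk1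
    dsimp only [Store.tick] at hptr hclk1 ⊢
    rw [hl] at hptr hclk1
    have hptr' : ∀ q < I.K, ptr q = bot (M / m ^ q % m) := fun q hq => by
      rw [hptr q hq, hbot, hD q hq]
    refine sat_seq (sat_propagate ⟨ck, cn, c1⟩ hl ?_ ?_ ?_)
    · dsimp only; rw [hprd, hnxt]; exact hlinks
    · intro q hq
      dsimp only
      rw [hptr' q hq]
      exact hL.lt _ (Nat.mod_lt _ hm)
    intro f g i j a t u c v w ptr2 clk2 hclk2 hf
    dsimp only at hclk2 hf ⊢
    refine sat_ite (satTest_teq _ _ _) ?_ ?_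
    · intro hf1
      replace hf1 : f = 1 := hf1.trans c1
      have hfail := (hf.resolve_left (by omega)).2
      have hno' : ∀ M' < M + 1, ∀ s, Solution I s →
          ¬ ∀ q < I.K, Reach I h.nxt (bot (M' / m ^ q % m)) (s q) := by
        intro M' hM' s hs hreach
        by_cases hMM : M' = M
        · subst hMM
          refine hfail s hs fun q hq => ?_
          rw [hnxt, hptr' q hq]
          exact hreach q hq
        · exact hno M' (by omega) s hs hreach
      refine sat_increment (M := M) ⟨ck, cn, c1⟩ ?_ ?_ ?_ ?_
      · dsimp only [Store.tick]; omega
      · dsimp only [Store.tick]; omega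
      · dsimp only [Store.tick]; rw [hm']; exact hD
      intro c i t dig2 go2 clk3 hD2 hg0 hg1 hclk3
      dsimp only [Store.tick] at hD2 hg0 hg1 hclk3 ⊢
      rw [hm'] at hD2 hg0 hg1
      by_cases hdiv : m ^ I.K ∣ M + 1
      -- Since M + 1 ≤ m^K, divisibility means that all assignments have been tried.
      · have hlast : m ^ I.K = M + 1 := le_antisymm (Nat.le_of_dvd (by omega) hdiv) hM
        exact ⟨0, by omega, ⟨⟨ck, cn, c1⟩, hprd, hnxt, hbot, hm', hl, Or.inr ⟨hg0 hdiv,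
          Or.inr ⟨hres, hlast ▸ hno'⟩⟩⟩, by omega⟩
      · have hne : M + 1 ≠ m ^ I.K := by
          intro heq
          rw [heq] at hdiv
          exact hdiv dvd_rfl
        exact ⟨r - 1, by omega, ⟨⟨ck, cn, c1⟩, hprd, hnxt, hbot, hm', hl, Or.inl
          ⟨(hg1 hdiv).trans (hgo.trans c1), hres, M + 1, by omega, by omega, hD2, hno'⟩⟩,
          by omega⟩
    · intro hf1
      replace hf1 : f ≠ 1 := fun h => hf1 (h.trans c1.symm)
      have hsol := (hf.resolve_right fun h => hf1 h.1).2
      refine sat_seq (sat_assign le_rfl (sat_assign (by omega) ?_))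
      dsimp only [Store.tick, Store.set]
      exact ⟨0, by omega, ⟨⟨ck, cn, c1⟩, hprd, hnxt, hbot, hm', hl, Or.inr ⟨rfl,
          Or.inl ⟨rfl, _, hsol⟩⟩⟩, by omega⟩
  · rintro r h' ⟨⟨ck, cn, c1⟩, hprd, hnxt, hbot, hm', hl, hcase⟩ hgo hclk''
    dsimp only [Store.tick, Store.set] at hclk''
    rcases hcase with ⟨hgo', -⟩ | ⟨-, hcase⟩
    · exact absurd (hgo'.trans c1.symm) hgo
    have hpow : m ^ I.K * (500 * (I.K ^ 3 * I.N)) ≤ I.W ^ I.K * (500 * (I.K ^ 3 * I.N)) :=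
      Nat.mul_le_mul_right _ (Nat.pow_le_pow_left hmW _)
    refine hp _ (hcase.imp_right ?_) (by dsimp only [Store.tick]; omega)
    rintro ⟨hres, hno⟩
    refine ⟨hres, ?_⟩
    rintro ⟨s, hs⟩
    -- A solution determines an assignment: for each q, a chain through its image. The value 0
    -- beyond K is a dummy.
    have hex : ∀ q, ∃ d, q < I.K → d < m ∧ Reach I h.nxt (bot d) (s q) := by
      intro q
      by_cases hq : q < I.K
      · obtain ⟨d, hd⟩ := hL.exists_reach hlinks (s q) (hs.1 q hq)
        exact ⟨d, fun _ => hd⟩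
      · exact ⟨0, fun h => absurd h hq⟩
    choose f hf using hex
    obtain ⟨M, hM, hD⟩ := exists_digits hm I.K f fun q hq => (hf q hq).1
    refine hno M hM s hs fun q hq => ?_
    rw [← hD q hq]
    exact (hf q hq).2

/-! ### The decision program and its total cost -/

/-- Decide whether there is an embedding and put the answer into the variable `res`. -/
def decideEmbedding : Prog :=
  assign .one 1 ⨾ .ite (tlt .k .one) (assign .res 1)
    (.ite (tlt .n .one) (assign .res 0)
      (.ite (teq .k .one) (assign .res 1) (decompose ⨾ enumerate)))

/-- The program for the embedding problem. -/
def embeddingProg : Prog :=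
  .instr (.mul 4 0 0) ⨾ .instr (.mul 5 1 1) ⨾ .instr (.add 5 4 5) ⨾ .instr (.copy 6 0) ⨾
    .instr (.copy 7 1) ⨾ decideEmbedding ⨾ .instr (.copy 0 25)

/-- The decomposition costs about W²N², and `2 ≤ K` absorbs it through W² ≤ W^K. The factor 9 comes
from W + 2 ≤ 3W. -/
theorem total_cost {K N W : ℕ} (hK : 2 ≤ K) (hN : 1 ≤ N) (hW : 1 ≤ W) :
    N * (400 * N * (W + 2) ^ 2 + 1) + W ^ K * (500 * (K ^ 3 * N)) + 30 * N + 8 * K + 50 ≤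
      5000 * (W ^ K * K ^ 3 * N ^ 2) := by
  have hWK : 1 ≤ W ^ K := Nat.pow_pos hW
  have hK3 : 1 ≤ K ^ 3 := Nat.pow_pos (by omega)
  have hKK : K ≤ K ^ 3 := Nat.le_self_pow (by omega) K
  have hNN : N ≤ N ^ 2 := Nat.le_self_pow (by omega) N
  have hW2 : W ^ 2 ≤ W ^ K := Nat.pow_le_pow_right hW hK
  have h9 : (W + 2) ^ 2 ≤ 9 * W ^ K := by nlinarith
  have hA : N * (N * (W + 2) ^ 2) ≤ 9 * (W ^ K * K ^ 3 * N ^ 2) := by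
    calc N * (N * (W + 2) ^ 2) = (W + 2) ^ 2 * 1 * N ^ 2 := by ring
      _ ≤ (9 * W ^ K) * K ^ 3 * N ^ 2 := by gcongr
      _ = 9 * (W ^ K * K ^ 3 * N ^ 2) := by ring
  have hB : W ^ K * (K ^ 3 * N) ≤ W ^ K * K ^ 3 * N ^ 2 := by
    calc W ^ K * (K ^ 3 * N) = W ^ K * K ^ 3 * N := by ring
      _ ≤ W ^ K * K ^ 3 * N ^ 2 := by gcongr
  have hC : N ≤ W ^ K * K ^ 3 * N ^ 2 := by
    calc N = 1 * 1 * N := by ring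
      _ ≤ W ^ K * K ^ 3 * N ^ 2 := by gcongr
  have hD : K ≤ W ^ K * K ^ 3 * N ^ 2 := by
    calc K = 1 * K * 1 := by ring
      _ ≤ W ^ K * K ^ 3 * N ^ 2 := by gcongr; omega
  have e1 : N * (400 * N * (W + 2) ^ 2 + 1) = 400 * (N * (N * (W + 2) ^ 2)) + N := by ring
  have e2 : W ^ K * (500 * (K ^ 3 * N)) = 500 * (W ^ K * (K ^ 3 * N)) := by ring
  omega

open Classical in
theorem sat_decideEmbedding {h : Store} {Post : Store → Prop} (hk : h.k = I.K) (hn : h.n = I.N)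
    (hq : ∀ i < I.K, I.qle i i)
    (hp : ∀ h' : Store, h'.res = (if ∃ s, Solution I s then 1 else 0) →
      h'.clk + 6 ≤ h.clk + 5000 * max 1 (I.W ^ I.K * I.K ^ 3 * I.N ^ 2) → Post h') :
    Sat I decideEmbedding h Post := by
  have hmax : 1 ≤ max 1 (I.W ^ I.K * I.K ^ 3 * I.N ^ 2) := le_max_left _ _
  refine sat_seq (sat_assign le_rfl (sat_ite (satTest_tlt _ _ _) ?_ ?_))
  · intro hlt
    replace hlt : h.k < 1 := hlt
    refine sat_assign le_rfl (hp _ ?_ ?_)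
    · have hsol : ∃ s, Solution I s := ⟨id, fun q hq => by omega, fun q hq => by omega⟩
      rw [if_pos hsol]; rfl
    · dsimp only [Store.tick, Store.set]; omega
  intro hlt
  replace hlt : ¬ h.k < 1 := hlt
  refine sat_ite (satTest_tlt _ _ _) ?_ ?_
  · intro hlt'
    replace hlt' : h.n < 1 := hlt'
    refine sat_assign (by omega) (hp _ ?_ ?_)
    · have hsol : ¬ ∃ s, Solution I s := by
        rintro ⟨s, hs, -⟩
        have := hs 0 (by omega)
        omega
      rw [if_neg hsol]; rfl
    · dsimp only [Store.tick, Store.set]; omega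
  intro hlt'
  replace hlt' : ¬ h.n < 1 := hlt'
  refine sat_ite (satTest_teq _ _ _) ?_ ?_
  -- For K = 1 the bound W·N² need not cover the decomposition, but any element of the nonempty P is
  -- a valid image.
  · intro hone
    replace hone : h.k = 1 := hone
    refine sat_assign le_rfl (hp _ ?_ ?_)
    · have hsol : ∃ s, Solution I s := by
        refine ⟨fun _ => 0, fun q _ => by dsimp only; omega, fun q hq1 q' hq2 => ?_⟩
        obtain rfl : q = q' := by omega
        exact iff_of_true (hq q hq1) (I.le_refl 0 (by omega))
      rw [if_pos hsol]; rfl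
    · dsimp only [Store.tick, Store.set]; omega
  intro hone
  replace hone : h.k ≠ 1 := hone
  have hW : 1 ≤ I.W := I.width 1 (fun _ => 0) (fun _ _ => by omega) (fun _ _ _ _ _ => by omega)
  have hcost := total_cost (K := I.K) (N := I.N) (W := I.W) (by omega) (by omega) hW
  have hmax' : I.W ^ I.K * I.K ^ 3 * I.N ^ 2 ≤ max 1 (I.W ^ I.K * I.K ^ 3 * I.N ^ 2) :=
    le_max_right _ _
  refine sat_seq (sat_decompose ⟨hk, hn, rfl⟩ ?_)
  intro h1 hc1 hl1 hcard1 hclk1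
  refine sat_enumerate hc1 (by omega) (by omega) hl1 hcard1 ?_
  intro h2 hres hclk2
  dsimp only [Store.tick, Store.set] at hclk1
  refine hp _ ?_ (by omega)
  rcases hres with ⟨hr, hs⟩ | ⟨hr, hs⟩
  · rw [if_pos hs, hr]
  · rw [if_neg hs, hr]

/-- The abstract state in which the input has been read. -/
def Store.init (K N : ℕ) : Store where
  k := K
  n := N
  one := 0
  x := 0
  m := 0
  l := 0
  lim := 0
  i := 0
  j := 0
  f := 0
  g := 0
  go := 0
  v := 0
  w := 0
  t := 0
  u := 0
  y := 0
  a := 0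
  c := 0
  res := 0
  prd := fun _ => 0
  nxt := fun _ => 0
  ptr := fun _ => 0
  wit := fun _ => 0
  bot := fun _ => 0
  dig := fun _ => 0
  clk := 0

/-! ### From posets and their encoding to instances -/

section input

variable {Q P : Type*} [Fintype Q] [PartialOrder Q] [Fintype P] [PartialOrder P]
  (eQ : Fin (Fintype.card Q) ≃ Q) (eP : Fin (Fintype.card P) ≃ P)

theorem card_le_posetWidth {m : ℕ} (f : Fin m → P) (hf : ∀ i j, i ≠ j → ¬ f i ≤ f j) :
    m ≤ posetWidth P := by
  classical
  have hinj : Function.Injective f := by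
    intro i j hij
    by_contra hne
    exact hf i j hne hij.le
  have hcard : (Finset.univ.image f).card = m := by
    rw [Finset.card_image_of_injective _ hinj, Finset.card_univ, Fintype.card_fin]
  unfold posetWidth
  refine hcard.symm.le.trans (Finset.le_sup (f := Finset.card) ?_)
  simp only [Finset.mem_filter, Finset.mem_univ, true_and]
  intro a ha b hb hab
  simp only [Finset.coe_image, Finset.coe_univ, Set.image_univ, Set.mem_range] at ha hb
  obtain ⟨i, rfl⟩ := ha
  obtain ⟨j, rfl⟩ := hb
  exact hf i j fun h => hab (h ▸ rfl)

/-- The order of a poset with numbered elements, as a relation between numbers. -/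
def numLE {X : Type*} [PartialOrder X] {c : ℕ} (e : Fin c ≃ X) (i j : ℕ) : Prop :=
  ∃ (hi : i < c) (hj : j < c), e ⟨i, hi⟩ ≤ e ⟨j, hj⟩

/-- The problem instance given by two posets with numbered elements. -/
noncomputable def inputInst (b : ℕ)
    (hb : 16 * (Fintype.card Q + Fintype.card P + 1) ^ 2 ≤ 2 ^ b) : Inst where
  b := b
  K := Fintype.card Q
  N := Fintype.card P
  W := posetWidth P
  qle := numLE eQ
  le := numLE eP
  word := hb
  le_refl := fun _ hi => ⟨hi, hi, le_rfl⟩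
  le_trans := fun _ _ _ ⟨h1, _, h3⟩ ⟨_, h5, h6⟩ => ⟨h1, h5, h3.trans h6⟩
  le_antisymm := fun _ _ ⟨_, _, h3⟩ ⟨_, _, h6⟩ =>
    congrArg Fin.val (eP.injective (le_antisymm h3 h6))
  width := fun m e he ha => card_le_posetWidth (fun i : Fin m => eP ⟨e i, he i i.2⟩)
    fun i j hij hle => ha i i.2 j j.2 (fun h => hij (Fin.ext h)) ⟨_, _, hle⟩

/-- A solution is not required to be injective: preserving and reflecting the order forces this by
antisymmetry in Q. -/
theorem exists_solution_iff (b : ℕ)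
    (hb : 16 * (Fintype.card Q + Fintype.card P + 1) ^ 2 ≤ 2 ^ b) :
    (∃ s, Solution (inputInst eQ eP b hb) s) ↔ Nonempty (Q ↪o P) := by
  constructor
  · rintro ⟨s, h1, h2⟩
    refine ⟨OrderEmbedding.ofMapLEIff
      (fun q => eP ⟨s (eQ.symm q), h1 _ (eQ.symm q).2⟩) fun q q' => ?_⟩
    have h := h2 _ (eQ.symm q).2 _ (eQ.symm q').2
    constructor
    · intro hle
      obtain ⟨_, _, h'⟩ := h.2 ⟨_, _, hle⟩
      simpa using h'
    · intro hle
      obtain ⟨_, _, h'⟩ := h.1 ⟨(eQ.symm q).2, (eQ.symm q').2, by simpa using hle⟩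
      exact h'
  · rintro ⟨φ⟩
    -- The value 0 outside the range of Q is a dummy.
    refine ⟨fun i => if h : i < Fintype.card Q then (eP.symm (φ (eQ ⟨i, h⟩)) : ℕ) else 0,
      fun q hq => ?_, fun q hq q' hq' => ?_⟩
    · have hq1 : q < Fintype.card Q := hq
      dsimp only
      rw [dif_pos hq1]; exact (eP.symm _).2
    · have hq1 : q < Fintype.card Q := hq
      have hq2 : q' < Fintype.card Q := hq'
      dsimp only
      rw [dif_pos hq1, dif_pos hq2]
      constructor
      · rintro ⟨_, _, h⟩
        exact ⟨(eP.symm _).2, (eP.symm _).2, by simpa using h⟩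
      · rintro ⟨_, _, h⟩
        exact ⟨hq1, hq2, by simpa using h⟩

theorem mul_add_inj {c i j i' j' : ℕ} (hj : j < c) (hj' : j' < c)
    (h : i * c + j = i' * c + j') : i = i' ∧ j = j' := by
  have hc : 0 < c := by omega
  have h1 : i = i' := by
    have := congrArg (· / c) h
    simpa [Nat.add_comm, Nat.add_mul_div_right _ _ hc, Nat.div_eq_of_lt hj,
      Nat.div_eq_of_lt hj'] using this
  subst h1
  exact ⟨rfl, by omega⟩

open Classical in
-- The matrices occupy disjoint blocks of addresses below K² + N², and the memory beyond is 0, so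
-- all arrays start as zero.
theorem sim_init (b : ℕ) (hb : 16 * (Fintype.card Q + Fintype.card P + 1) ^ 2 ≤ 2 ^ b)
    {s : State} (hmem : s.mem = (posetPairInput eQ eP).mem)
    (h0 : s.reg 0 = Fintype.card Q) (h1 : s.reg 1 = Fintype.card P)
    (h4 : s.reg 4 = Fintype.card Q * Fintype.card Q)
    (h5 : s.reg 5 = Fintype.card Q * Fintype.card Q + Fintype.card P * Fintype.card P)
    (h6 : s.reg 6 = Fintype.card Q) (h7 : s.reg 7 = Fintype.card P)
    (h8 : ∀ r, 8 ≤ r → s.reg r = 0) :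
    Sim (inputInst eQ eP b hb) (Store.init (Fintype.card Q) (Fintype.card P)) s := by
  have hlt : ∀ {c i j : ℕ}, i < c → j < c → i * c + j < c * c := by
    intro c i j hi hj
    nlinarith
  refine ⟨h0, h1, h4, h5, ?_, ?_, ?_, ?_, ?_, ?_⟩
  · intro u
    cases u <;> first | exact h6 | exact h7 | exact h8 _ (by simp [Var.reg])
  · intro r i
    have hz : (Store.init (Fintype.card Q) (Fintype.card P)).getA r i = 0 := by cases r <;> rfl
    rw [hz, hmem]
    simp only [posetPairInput, inputInst]
    rw [if_neg]
    rintro (⟨a, c, h, -⟩ | ⟨a, c, h, -⟩)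
    · have := hlt a.2 c.2; omega
    · have := hlt a.2 c.2; omega
  · intro i hi j hj
    rw [hmem]
    simp only [inputInst] at hi hj
    simp only [posetPairInput, inputInst]
    refine if_congr ⟨?_, ?_⟩ rfl rfl
    · rintro (⟨a, c, h, hle⟩ | ⟨a, c, h, -⟩)
      · obtain ⟨rfl, rfl⟩ := mul_add_inj hj c.2 h
        exact ⟨_, _, hle⟩
      · have := hlt hi hj; omega
    · rintro ⟨_, _, hle⟩
      exact Or.inl ⟨⟨i, hi⟩, ⟨j, hj⟩, rfl, hle⟩
  · intro i hi j hj
    rw [hmem]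
    simp only [inputInst] at hi hj
    simp only [posetPairInput, inputInst]
    refine if_congr ⟨?_, ?_⟩ rfl rfl
    · rintro (⟨a, c, h, -⟩ | ⟨a, c, h, hle⟩)
      · have := hlt a.2 c.2; omega
      · obtain ⟨rfl, rfl⟩ := mul_add_inj (i := i) (i' := a) hj c.2 (by omega)
        exact ⟨_, _, hle⟩
    · rintro ⟨_, _, hle⟩
      exact Or.inr ⟨⟨i, hi⟩, ⟨j, hj⟩, rfl, hle⟩
  · intro u
    cases u <;> simp [Store.init, Store.get, Inst.bd, inputInst] <;> omega
  · intro r i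
    cases r <;> simp [Store.init, Store.getA]

open Classical in
theorem exec_embeddingProg (b : ℕ)
    (hb : 16 * (Fintype.card Q + Fintype.card P + 1) ^ 2 ≤ 2 ^ b) :
    ∃ (s : State) (t : ℕ), Exec b embeddingProg (posetPairInput eQ eP) s t ∧
      s.reg 0 = (if Nonempty (Q ↪o P) then 1 else 0) ∧
      t ≤ 5000 * max 1
        (posetWidth P ^ Fintype.card Q * Fintype.card Q ^ 3 * Fintype.card P ^ 2) := by
  have hw : Fintype.card Q * Fintype.card Q + Fintype.card P * Fintype.card P + Fintype.card Q + Fintype.card P < 2 ^ b := by nlinarith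
  let s1 : State := ⟨Function.update (Function.update (Function.update (Function.update
    (Function.update (posetPairInput eQ eP).reg 4 (Fintype.card Q * Fintype.card Q)) 5 (Fintype.card P * Fintype.card P)) 5 (Fintype.card Q * Fintype.card Q + Fintype.card P * Fintype.card P)) 6 (Fintype.card Q)) 7 (Fintype.card P),
    (posetPairInput eQ eP).mem⟩
  have hsim : Sim (inputInst eQ eP b hb) (Store.init (Fintype.card Q) (Fintype.card P)) s1 := by
    refine sim_init eQ eP b hb rfl ?_ ?_ ?_ ?_ ?_ ?_ ?_
    · simp [s1, posetPairInput]
    · simp [s1, posetPairInput]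
    · simp [s1]
    · simp [s1]
    · simp [s1]
    · simp [s1]
    · intro r hr
      simp only [s1]
      rw [Function.update_of_ne (by omega), Function.update_of_ne (by omega),
        Function.update_of_ne (by omega), Function.update_of_ne (by omega),
        Function.update_of_ne (by omega)]
      simp only [posetPairInput]
      rw [if_neg (by omega), if_neg (by omega)]
  obtain ⟨s2, t, h2, hexec, hsim2, hclk, hres, hclk2⟩ := sat_decideEmbedding
    (I := inputInst eQ eP b hb) (h := Store.init (Fintype.card Q) (Fintype.card P))
    (Post := fun h' => h'.res = (if ∃ s, Solution (inputInst eQ eP b hb) s then 1 else 0) ∧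
      -- The slack 6 pays for the five setup instructions and the final copy of the answer.
      h'.clk + 6 ≤ 5000 * max 1 (posetWidth P ^ Fintype.card Q * Fintype.card Q ^ 3 * Fintype.card P ^ 2)) rfl rfl
    (fun i hi => ⟨hi, hi, le_rfl⟩) (fun h' a1 a2 => ⟨a1, by simpa [Store.init, inputInst] using a2⟩) s1 hsim
  have hreg : s2.reg 25 = if Nonempty (Q ↪o P) then 1 else 0 := by
    have h := hsim2.var .res
    rw [show Store.get h2 .res = h2.res from rfl, hres] at h
    rw [show s2.reg 25 = s2.reg (Var.reg .res) from rfl, h]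
    exact if_congr (exists_solution_iff eQ eP b hb) rfl rfl
  refine ⟨_, _, .seq (exec_setReg (d := 4) (e := Fintype.card Q * Fintype.card Q) ?_ ?_)
    (.seq (exec_setReg (d := 5) (e := Fintype.card P * Fintype.card P) ?_ ?_)
    (.seq (exec_setReg (d := 5) (e := Fintype.card Q * Fintype.card Q + Fintype.card P * Fintype.card P) ?_ ?_)
    (.seq (exec_setReg (d := 6) (e := Fintype.card Q) ?_ ?_)
    (.seq (exec_setReg (d := 7) (e := Fintype.card P) ?_ ?_)
    (.seq hexec (exec_setReg (d := 0) (e := s2.reg 25) rfl ?_)))))), ?_, ?_⟩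
  · simp [Instr.step, posetPairInput]
  · omega
  · simp [Instr.step, posetPairInput]
  · omega
  · simp [Instr.step]
  · omega
  · simp [Instr.step, posetPairInput]
  · omega
  · simp [Instr.step, posetPairInput]
  · omega
  · rw [hreg]
    have : 1 < 2 ^ b := by
      refine lt_of_lt_of_le ?_ hb
      nlinarith
    split_ifs <;> omega
  · simp [hreg]
  · simp only [Store.init] at hclk
    omega

end input

end WordRAM

open Classical in
theorem mainTheorem2 :
    ∃ (prog : WordRAM.Prog) (c C : ℕ),
      ∀ (Q P : Type) [Fintype Q] [PartialOrder Q] [Fintype P] [PartialOrder P]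
        (eQ : Fin (Fintype.card Q) ≃ Q) (eP : Fin (Fintype.card P) ≃ P)
        (b : ℕ), c * (Fintype.card Q + Fintype.card P + 1) ^ 2 ≤ 2 ^ b →
        ∃ (s : WordRAM.State) (t : ℕ),
          WordRAM.Exec b prog (WordRAM.posetPairInput eQ eP) s t ∧
          s.reg 0 = (if Nonempty (Q ↪o P) then 1 else 0) ∧
          t ≤ C * max 1
            (posetWidth P ^ Fintype.card Q * Fintype.card Q ^ 3 * Fintype.card P ^ 2) :=
  ⟨WordRAM.embeddingProg, 16, 5000, fun _ _ _ _ _ _ eQ eP b hb =>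
    WordRAM.exec_embeddingProg eQ eP b hb⟩
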